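/- Let $d\ge 1$ and $s<d$. Let $\gamma_1:(0,\infty)\to[0,\infty)$ be nonincreasing, with $\gamma_1(r)=D_0r^{-s}$ for $0<r<1$, $\gamma_1(r)=0$ for $r\ge1$ and $\int_{B_1(0)}\gamma_1(|z|)|z|^2\,dz=d$, and put $\gamma_\delta(r)=\delta^{-(d+2)}\gamma_1(r/\delta)$. Here $B_\delta(x)=\{y:|y-x|<\delta\}$. Let $\Omega\subset\mathbb R^d$ be a nonempty bounded open set and, for $\delta>0$, let $\Omega_\delta=\{x\notin\Omega:\operatorname{dist}(x,\partial\Omega)<\delta\}$. For an open set $U$, $C^4(U)$ is the space of $C^4$ functions on $U$ whose derivatives of order at most $4$ are bounded. Fix $\bar\delta>0$, put $D=\Omega\cup\Omega_{\bar\delta}$, and let $A:D\times D\to\mathbb R$ be symmetric with $0<r\le A\le R<\infty$, $A(x,\cdot)\in C^4(D)$ with norm bounded uniformly in $x\in D$, and $a(x):=A(x,x)$ of class $C^\infty$ in $\Omega$. Let $f:\Omega\to\mathbb R$ and $u^D:\Omega_{\bar\delta}\to\mathbb R$ be given. *Local problem.* Let $u^0\in C^4(D)$ satisfy $-\nabla\cdot(a\nabla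 u^0)=f$ in $\Omega$ and $u^0=u^D$ on $\Omega_{\bar\delta}$ (in particular on $\partial\Omega$). *Nonlocal problem.* For $0<\delta<\bar\delta$, a nonlocal solution $u^\delta$ is a function on $\Omega\cup\Omega_\delta$ with $$-2\int A(x,y)\gamma_\delta(|x-y|)\,(u^\delta(y)-u^\delta(x))\,dy=f(x)\quad(x\in\Omega),\qquad u^\delta=u^D\ \text{ on }\Omega_\delta,$$ the integrals being convergent. *Meshfree scheme.* For $h>0$ let $\chi_h=h\mathbb Z^d\cap(\Omega\cup\Omega_\delta)$. For $x_i\in\chi_h\cap\Omega$ let $N_i=(\chi_h\cap B_\delta(x_i))\setminus\{x_i\}$, and let the weights $(\omega_{j,i})_{x_j\in N_i}$ minimize $\sum_{x_j\in N_i}\tfrac12\omega_{j,i}^2\gamma_\delta(|x_j-x_i|)$ subject to $$\sum_{x_j\in N_i}p(x_j-x_i)\gamma_\delta(|x_j-x_i|)\,\omega_{j,i}=\int_{B_\delta(x_i)}p(y-x_i)\gamma_\delta(|y-x_i|)\,dy$$ for all polynomials $p$ in $d$ variables of degree at most $3$. The discrete solution $u_h^\delta:\chi_h\to\mathbb R$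 is given by $$-2\sum_{x_j\in N_i}A(x_i,x_j)\gamma_\delta(|x_i-x_j|)\,(u_h^\delta(x_j)-u_h^\delta(x_i))\,\omega_{j,i}=f(x_i)\quad(x_i\in\chi_h\cap\Omega),\qquad u_h^\delta=u^D\ \text{ on }\chi_h\cap\Omega_\delta.$$ Call $C_{pos}>0$ a *positivity constant* if, for all $\delta>0$, all $0<h<C_{pos}\delta$ and all $x_i\in\chi_h\cap\Omega$, no nonzero polynomial $p$ of degree at most $3$ has $p(x_j-x_i)=0$ for all $x_j\in N_i$, the optimization problem for the weights is solvable, and the optimal weights are all positive. **Theorem.** A positivity constant exists. For every positivity constant $C_{pos}$ there are $\delta_0\in(0,\bar\delta]$ and $C>0$ such that, for every fixed ratio $h/\delta=\rho\in(0,C_{pos})$ and all $0<\delta<\delta_0$, the discrete solution $u^\delta_h$ exists and is unique, and 1. $\|u_h^\delta-u^\delta\|_{L^\infty(\chi_h)}=\max_{x\in\chi_h}|u_h^\delta(x)-u^\delta(x)|\le C\delta^2$ for every nonlocal solution $u^\delta$ with $u^\delta\in C^4(\Omega)$; 2. $\|u_h^\delta-u^0\|_{L^\infty(\chi_h)}\le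 C\delta^2$, that is, the scheme is asymptotically compatible. The constant $C$ does not depend on $\delta$ (nor on $\rho$ or $u^\delta$). -/

import Mathlib

open MeasureTheory Set
open scoped ContDiff

noncomputable section

/-- `u` is of class `C⁴` on the open set `U`, with all derivatives of order at most four bounded
by `K` there. -/
def HasC4Bound {d : ℕ} (U : Set (EuclideanSpace ℝ (Fin d))) (K : ℝ)
    (u : EuclideanSpace ℝ (Fin d) → ℝ) : Prop :=
  ContDiffOn ℝ 4 u U ∧ ∀ k : ℕ, k ≤ 4 → ∀ x ∈ U, ‖iteratedFDerivWithin ℝ k u U x‖ ≤ K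

/-- The class `C⁴(U)` of functions with finite norm `‖u‖_{C⁴(U)}`, for `U` open. -/
def IsC4 {d : ℕ} (U : Set (EuclideanSpace ℝ (Fin d)))
    (u : EuclideanSpace ℝ (Fin d) → ℝ) : Prop :=
  ∃ K : ℝ, HasC4Bound U K u

/-- The nonlocal boundary `Ω_δ`: the points outside `Ω` at distance less than `δ` from `∂Ω`. -/
def nonlocalBoundary {d : ℕ} (Ω : Set (EuclideanSpace ℝ (Fin d))) (δ : ℝ) :
    Set (EuclideanSpace ℝ (Fin d)) :=
  {x | x ∉ Ω ∧ Metric.infDist x (frontier Ω) < δ}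

/-- `Ω ∪ Ω_δ`. -/
def extendedDomain {d : ℕ} (Ω : Set (EuclideanSpace ℝ (Fin d))) (δ : ℝ) :
    Set (EuclideanSpace ℝ (Fin d)) :=
  Ω ∪ nonlocalBoundary Ω δ

/-- The profile `γ₁` of the kernel, as a function of the radius: `γ₁(r) = D₀ / r ^ s` for
`0 < r < 1` and `γ₁(r) = 0` for `r ≥ 1`, nonnegative and nonincreasing in `r > 0`, with
`∫_{B₁(0)} γ₁(|z|) |z|² dz = d`. The value at `r = 0` is immaterial. -/
structure IsKernelProfile (d : ℕ) (s : ℝ) (γ₁ : ℝ → ℝ) : Prop where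
  nonneg : ∀ r : ℝ, 0 < r → 0 ≤ γ₁ r
  antitone : AntitoneOn γ₁ (Ioi 0)
  power : ∃ D₀ : ℝ, ∀ r : ℝ, 0 < r → r < 1 → γ₁ r = D₀ / r ^ s
  support : ∀ r : ℝ, 1 ≤ r → γ₁ r = 0
  moment : ∫ z in Metric.ball (0 : EuclideanSpace ℝ (Fin d)) 1, γ₁ ‖z‖ * ‖z‖ ^ 2 = d

/-- The rescaled kernel `γ_δ(r) = δ^{-(d+2)} γ₁(r / δ)`. -/
def rescaledKernel (d : ℕ) (γ₁ : ℝ → ℝ) (δ r : ℝ) : ℝ :=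
  1 / δ ^ (d + 2) * γ₁ (r / δ)

/-- The diffusion coefficient on `D × D`: symmetric, `0 < r ≤ A ≤ R`, and `A(x, ·)` is of class
`C⁴` with bounds that are uniform in `x`. -/
structure IsDiffusionCoefficient {d : ℕ} (D : Set (EuclideanSpace ℝ (Fin d))) (r R : ℝ)
    (A : EuclideanSpace ℝ (Fin d) → EuclideanSpace ℝ (Fin d) → ℝ) : Prop where
  pos : 0 < r
  symm : ∀ x ∈ D, ∀ y ∈ D, A x y = A y x
  lower : ∀ x ∈ D, ∀ y ∈ D, r ≤ A x y
  upper : ∀ x ∈ D, ∀ y ∈ D, A x y ≤ R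
  smooth : ∃ K : ℝ, ∀ x ∈ D, HasC4Bound D K (A x)

/-- The nonlocal diffusion operator
`L^δ[u](x) = 2 ∫ A(x, y) γ_δ(|x - y|) (u(y) - u(x)) dy`. -/
def nonlocalOperator {d : ℕ} (A : EuclideanSpace ℝ (Fin d) → EuclideanSpace ℝ (Fin d) → ℝ)
    (γ₁ : ℝ → ℝ) (δ : ℝ) (u : EuclideanSpace ℝ (Fin d) → ℝ)
    (x : EuclideanSpace ℝ (Fin d)) : ℝ :=
  2 * ∫ y, A x y * rescaledKernel d γ₁ δ ‖x - y‖ * (u y - u x)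

/-- `-L^δ[u] = f` in `Ω`, with convergent integrals, and `u = u^D` on `Ω_δ`. -/
structure IsNonlocalSolution {d : ℕ} (Ω : Set (EuclideanSpace ℝ (Fin d)))
    (A : EuclideanSpace ℝ (Fin d) → EuclideanSpace ℝ (Fin d) → ℝ) (γ₁ : ℝ → ℝ) (δ : ℝ)
    (f uD u : EuclideanSpace ℝ (Fin d) → ℝ) : Prop where
  integrable : ∀ x ∈ Ω,
    Integrable (fun y => A x y * rescaledKernel d γ₁ δ ‖x - y‖ * (u y - u x))
  equation : ∀ x ∈ Ω, -nonlocalOperator A γ₁ δ u x = f x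
  boundary : ∀ x ∈ nonlocalBoundary Ω δ, u x = uD x

/-- The local operator `L⁰[u] = -∇ · (a ∇u)`. -/
def localOperator {d : ℕ} (a u : EuclideanSpace ℝ (Fin d) → ℝ)
    (x : EuclideanSpace ℝ (Fin d)) : ℝ :=
  -∑ i : Fin d, fderiv ℝ
    (fun y => a y * fderiv ℝ u y (EuclideanSpace.single i 1)) x (EuclideanSpace.single i 1)

/-- `L⁰[u] = f` in `Ω` and `u = u^D` on `∂Ω`. -/
structure IsLocalSolution {d : ℕ} (Ω : Set (EuclideanSpace ℝ (Fin d)))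
    (a f uD u : EuclideanSpace ℝ (Fin d) → ℝ) : Prop where
  equation : ∀ x ∈ Ω, localOperator a u x = f x
  boundary : ∀ x ∈ frontier Ω, u x = uD x

/-- The uniform Cartesian grid `χ_h = h ℤ^d ∩ (Ω ∪ Ω_δ)`. -/
def grid {d : ℕ} (Ω : Set (EuclideanSpace ℝ (Fin d))) (δ h : ℝ) :
    Set (EuclideanSpace ℝ (Fin d)) :=
  {x | ∃ k : Fin d → ℤ, ∀ i, x i = k i * h} ∩ extendedDomain Ω δ

/-- The quadrature points `χ_h ∩ B_δ(x) \ {x}`; this set is finite when `h > 0`, so that the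
sums `∑ᶠ` over it below are genuine finite sums. -/
def neighbors {d : ℕ} (Ω : Set (EuclideanSpace ℝ (Fin d))) (δ h : ℝ)
    (x : EuclideanSpace ℝ (Fin d)) : Set (EuclideanSpace ℝ (Fin d)) :=
  (grid Ω δ h ∩ Metric.ball x δ) \ {x}

/-- Value at `z` of a polynomial in `d` variables. -/
def polyVal {d : ℕ} (p : MvPolynomial (Fin d) ℝ) (z : EuclideanSpace ℝ (Fin d)) : ℝ :=
  MvPolynomial.eval (fun i => z i) p

/-- The quadrature points around `x` are unisolvent: a polynomial of degree at most three that
vanishes at all of them is zero. -/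
def IsUnisolvent {d : ℕ} (Ω : Set (EuclideanSpace ℝ (Fin d))) (δ h : ℝ)
    (x : EuclideanSpace ℝ (Fin d)) : Prop :=
  ∀ p : MvPolynomial (Fin d) ℝ, p.totalDegree ≤ 3 →
    (∀ y ∈ neighbors Ω δ h x, polyVal p (y - x) = 0) → p = 0

/-- The constraint of the quadrature problem: the rule with weights `w` at the quadrature points
around `x` integrates exactly over `B_δ(x)` every function `y ↦ p(y - x) γ_δ(|x - y|)`, where `p`
is a polynomial of degree at most three. -/
def IsReproducing {d : ℕ} (Ω : Set (EuclideanSpace ℝ (Fin d))) (γ₁ : ℝ → ℝ) (δ h : ℝ)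
    (x : EuclideanSpace ℝ (Fin d)) (w : EuclideanSpace ℝ (Fin d) → ℝ) : Prop :=
  ∀ p : MvPolynomial (Fin d) ℝ, p.totalDegree ≤ 3 →
    (∑ᶠ y ∈ neighbors Ω δ h x, polyVal p (y - x) * rescaledKernel d γ₁ δ ‖x - y‖ * w y)
      = ∫ y in Metric.ball x δ, polyVal p (y - x) * rescaledKernel d γ₁ δ ‖x - y‖

/-- The objective function of the quadrature problem, with weight function `W = γ_δ`. -/
def quadratureObjective {d : ℕ} (Ω : Set (EuclideanSpace ℝ (Fin d))) (γ₁ : ℝ → ℝ) (δ h : ℝ)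
    (x : EuclideanSpace ℝ (Fin d)) (w : EuclideanSpace ℝ (Fin d) → ℝ) : ℝ :=
  ∑ᶠ y ∈ neighbors Ω δ h x, w y ^ 2 * rescaledKernel d γ₁ δ ‖y - x‖ / 2

/-- `w` (only its values at the quadrature points around `x` matter) solves the quadrature
problem at `x`. -/
def IsOptimalWeight {d : ℕ} (Ω : Set (EuclideanSpace ℝ (Fin d))) (γ₁ : ℝ → ℝ) (δ h : ℝ)
    (x : EuclideanSpace ℝ (Fin d)) (w : EuclideanSpace ℝ (Fin d) → ℝ) : Prop :=
  IsReproducing Ω γ₁ δ h x w ∧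
    ∀ v : EuclideanSpace ℝ (Fin d) → ℝ, IsReproducing Ω γ₁ δ h x v →
      quadratureObjective Ω γ₁ δ h x w ≤ quadratureObjective Ω γ₁ δ h x v

/-- `C` is an admissible value of `C_pos`: whenever `0 < h < C δ`, at every grid point of `Ω` the
quadrature points are unisolvent, the quadrature problem is solvable, and the optimal weights are
positive. -/
def IsPositivityConstant {d : ℕ} (Ω : Set (EuclideanSpace ℝ (Fin d))) (γ₁ : ℝ → ℝ)
    (C : ℝ) : Prop :=
  0 < C ∧ ∀ δ h : ℝ, 0 < δ → 0 < h → h < C * δ → ∀ x ∈ grid Ω δ h ∩ Ω,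
    IsUnisolvent Ω δ h x ∧
    (∃ w, IsOptimalWeight Ω γ₁ δ h x w) ∧
    ∀ w, IsOptimalWeight Ω γ₁ δ h x w → ∀ y ∈ neighbors Ω δ h x, 0 < w y

/-- `wt y x` is the weight of the grid point `y` in the quadrature rule around the grid point `x`
of `Ω`. -/
def IsWeightFamily {d : ℕ} (Ω : Set (EuclideanSpace ℝ (Fin d))) (γ₁ : ℝ → ℝ) (δ h : ℝ)
    (wt : EuclideanSpace ℝ (Fin d) → EuclideanSpace ℝ (Fin d) → ℝ) : Prop :=
  ∀ x ∈ grid Ω δ h ∩ Ω, IsOptimalWeight Ω γ₁ δ h x (fun y => wt y x)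

/-- The discretized nonlocal diffusion operator `L_h^δ`. -/
def discreteOperator {d : ℕ} (Ω : Set (EuclideanSpace ℝ (Fin d)))
    (A : EuclideanSpace ℝ (Fin d) → EuclideanSpace ℝ (Fin d) → ℝ) (γ₁ : ℝ → ℝ) (δ h : ℝ)
    (wt : EuclideanSpace ℝ (Fin d) → EuclideanSpace ℝ (Fin d) → ℝ)
    (u : EuclideanSpace ℝ (Fin d) → ℝ) (x : EuclideanSpace ℝ (Fin d)) : ℝ :=
  2 * ∑ᶠ y ∈ neighbors Ω δ h x,
    A x y * rescaledKernel d γ₁ δ ‖x - y‖ * (u y - u x) * wt y x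

/-- The meshfree scheme: `-L_h^δ u = f` on `χ_h ∩ Ω` and `u = u^D` on `χ_h ∩ Ω_δ`. Only the values
of `u` on the grid matter. -/
structure IsDiscreteSolution {d : ℕ} (Ω : Set (EuclideanSpace ℝ (Fin d)))
    (A : EuclideanSpace ℝ (Fin d) → EuclideanSpace ℝ (Fin d) → ℝ) (γ₁ : ℝ → ℝ) (δ h : ℝ)
    (wt : EuclideanSpace ℝ (Fin d) → EuclideanSpace ℝ (Fin d) → ℝ)
    (f uD u : EuclideanSpace ℝ (Fin d) → ℝ) : Prop where
  equation : ∀ x ∈ grid Ω δ h ∩ Ω, -discreteOperator Ω A γ₁ δ h wt u x = f x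
  boundary : ∀ x ∈ grid Ω δ h ∩ nonlocalBoundary Ω δ, u x = uD x

end

/-! The proof is consistency plus stability, with every error measured against the local solution
`u0`. The functions `uδ` carry no `C⁴` bound uniform in `δ`, whereas `u0` is one fixed `C⁴`
function. Hence both `uh - u0` and `uδ - u0` are estimated, and the triangle inequality gives the
first error bound with a constant that does not see `uδ`.

Consistency. For fixed `x`, let `F(y) = A(x,y)(u(y) - u(x))` and expand `F` at `x` to third order.
The odd terms integrate to zero against the radial kernel, and the normalised second moments turn
the quadratic term into `ΔF(x)`, the `limitOperator`. The remainder is at most a constant times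
`|y-x|⁴ ≤ δ²|y-x|²`, and the kernel integrates `|y-x|²` to `d`, so the nonlocal operator is `O(δ²)`
close to its limit. The quadrature rule is exact for cubic polynomials times the kernel, `|y-x|²`
included, and its weights are positive. The same computation therefore applies to the discrete
operator, with the same constant for every ratio `h/δ` (`abs_nonlocalOperator_sub_limitOperator_le`,
`abs_discreteOperator_sub_limitOperator_le`).

The limit. One has `ΔF(x) = a Δu + 2 ∇₂A(x,x)·∇u`, which is `∇·(a∇u)` as soon as `∇a(x) = 2
∇₂A(x,x)`. For jointly smooth symmetric `A` this is the chain rule. Here only separate smoothness is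
given, and `fderiv_diagonal` replaces the chain rule by an interpolation argument.

Stability. An exponential barrier `b` has a limit operator bounded below by a positive constant, and
by consistency both operators inherit this for small `δ`. Adding a multiple of `b` to an error turns
it into a strict subsolution, to which a maximum principle applies (`discrete_stability`,
`nonlocal_stability`). In the discrete case this also gives uniqueness, hence existence by finite
dimension.

Positivity constant. After scaling by `δ`, the stencil is the punctured lattice of spacing `ε = h/δ`
in the unit ball, whatever `x`, `δ` and `Ω` are. The optimal weights are samples of a cubic
polynomial determined by a Gram system. As `ε → 0` the Gram matrices converge to an invertible one
and the polynomial, suitably normalised, converges to the constant 1, so it is positive for small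
`ε` (`exists_lattice_quadrature`). -/

/-! ### Sign, integrability and second moments of the kernel profile -/

/-- Neither sign is assumed. If `D₀ ≤ 0`, nonnegativity would make the kernel vanish inside the unit
ball, and its second moment could not be `d > 0`. If `s < 0`, the kernel would be strictly
increasing on `(0,1)`. The sign of `s` matters when the kernel at a lattice point is dominated by
its values across a cell. -/
theorem IsKernelProfile.exists_coeff {d : ℕ} (hd : 0 < d) {s : ℝ} {γ₁ : ℝ → ℝ}
    (hγ : IsKernelProfile d s γ₁) :
    0 ≤ s ∧ ∃ D₀ : ℝ, 0 < D₀ ∧ ∀ r : ℝ, 0 < r → r < 1 → γ₁ r = D₀ / r ^ s := by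
  obtain ⟨D₀, hD⟩ := hγ.power
  have hpos : 0 < D₀ := by
    by_contra! hle
    have hz : ∀ r, 0 < r → r < 1 → γ₁ r = 0 := by
      intro r h0 h1
      refine le_antisymm ?_ (hγ.nonneg r h0)
      rw [hD r h0 h1]
      exact div_nonpos_of_nonpos_of_nonneg hle (Real.rpow_nonneg h0.le _)
    have h := hγ.moment
    rw [setIntegral_congr_fun (g := fun _ => (0 : ℝ)) measurableSet_ball] at h
    · rw [integral_zero] at h
      exact hd.ne' (by exact_mod_cast h.symm)
    · intro z hz'
      rcases eq_or_ne z 0 with rfl | h0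
      · simp
      · have : γ₁ ‖z‖ = 0 := hz _ (norm_pos_iff.2 h0) (by simpa using hz')
        simp [this]
  refine ⟨?_, D₀, hpos, hD⟩
  by_contra! hs
  have h := hγ.antitone (show (1 / 4 : ℝ) ∈ Ioi 0 by norm_num)
    (show (1 / 2 : ℝ) ∈ Ioi 0 by norm_num) (by norm_num)
  rw [hD _ (by norm_num) (by norm_num), hD _ (by norm_num) (by norm_num)] at h
  have h2 : (1 / 2 : ℝ) ^ s < (1 / 4 : ℝ) ^ s :=
    Real.rpow_lt_rpow_of_neg (by norm_num) (by norm_num) hs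
  have h3 := div_lt_div_of_pos_left hpos (Real.rpow_pos_of_pos (by norm_num : (0:ℝ) < 1 / 2) s) h2
  linarith

/-- In polar coordinates the integrand becomes `y ^ (d - 1 - s)`, whose exponent exceeds `-1`
because `s < d`. -/
theorem integrableOn_norm_rpow_neg {d : ℕ} (hd : 0 < d) {s : ℝ} (hs : s < d) {ρ : ℝ} (hρ : 0 < ρ) :
    IntegrableOn (fun z : EuclideanSpace ℝ (Fin d) => ‖z‖ ^ (-s)) (Metric.ball 0 ρ) := by
  have : Nontrivial (EuclideanSpace ℝ (Fin d)) := by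
    have : Nonempty (Fin d) := ⟨⟨0, hd⟩⟩
    infer_instance
  rw [integrableOn_fun_norm_addHaar volume (f := fun r : ℝ => r ^ (-s))]
  have h : IntegrableOn (fun y : ℝ => y ^ ((d : ℝ) - 1 - s)) (Ioo 0 ρ) := by
    rw [intervalIntegral.integrableOn_Ioo_rpow_iff hρ]
    linarith
  refine h.congr_fun (fun y hy => ?_) measurableSet_Ioo
  simp only [finrank_euclideanSpace, Fintype.card_fin, smul_eq_mul]
  rw [← Real.rpow_natCast, ← Real.rpow_add hy.1]
  congr 1
  push_cast [Nat.cast_sub (show 1 ≤ d from hd)]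
  ring

theorem IsKernelProfile.integrableOn {d : ℕ} (hd : 0 < d) {s : ℝ} (hs : s < d) {γ₁ : ℝ → ℝ}
    (hγ : IsKernelProfile d s γ₁) :
    IntegrableOn (fun z : EuclideanSpace ℝ (Fin d) => γ₁ ‖z‖) (Metric.ball 0 1) := by
  obtain ⟨-, D₀, -, hD⟩ := hγ.exists_coeff hd
  have : Nonempty (Fin d) := ⟨⟨0, hd⟩⟩
  have h := ((integrableOn_norm_rpow_neg hd hs one_pos).const_mul D₀)
  refine Integrable.congr h ?_
  rw [Filter.EventuallyEq, ae_restrict_iff' measurableSet_ball]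
  have h0 : ∀ᵐ z : EuclideanSpace ℝ (Fin d), z ≠ 0 := by
    simp [ae_iff]
  filter_upwards [h0] with z hz hz1
  rw [hD _ (norm_pos_iff.2 hz) (by simpa using hz1), Real.rpow_neg (norm_nonneg _)]
  rfl

theorem IsKernelProfile.integrableOn_mul {d : ℕ} (hd : 0 < d) {s : ℝ} (hs : s < d) {γ₁ : ℝ → ℝ}
    (hγ : IsKernelProfile d s γ₁) {g : EuclideanSpace ℝ (Fin d) → ℝ} (hg : Continuous g) :
    IntegrableOn (fun z : EuclideanSpace ℝ (Fin d) => g z * γ₁ ‖z‖) (Metric.ball 0 1) := by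
  obtain ⟨C, hC⟩ := (isCompact_closedBall (0 : EuclideanSpace ℝ (Fin d)) 1).exists_bound_of_continuousOn
    hg.continuousOn
  refine Integrable.bdd_mul (c := C) (hγ.integrableOn hd hs) hg.aestronglyMeasurable ?_
  rw [ae_restrict_iff' measurableSet_ball]
  exact Filter.Eventually.of_forall fun z hz => hC z (Metric.ball_subset_closedBall hz)

theorem integral_ball_comp_isometry {d : ℕ} (γ₁ : ℝ → ℝ)
    (e : EuclideanSpace ℝ (Fin d) ≃ₗᵢ[ℝ] EuclideanSpace ℝ (Fin d))
    (g : EuclideanSpace ℝ (Fin d) → ℝ) :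
    ∫ z in Metric.ball 0 1, g (e z) * γ₁ ‖z‖ = ∫ z in Metric.ball 0 1, g z * γ₁ ‖z‖ := by
  have h := e.measurePreserving.setIntegral_preimage_emb
    e.toHomeomorph.measurableEmbedding (fun z => g z * γ₁ ‖z‖) (Metric.ball 0 1)
  have h2 : e ⁻¹' Metric.ball 0 1 = Metric.ball 0 1 := by ext; simp
  rw [← h, h2]
  simp

theorem integral_ball_odd {d : ℕ} (γ₁ : ℝ → ℝ) (g : EuclideanSpace ℝ (Fin d) → ℝ)
    (hg : ∀ z, g (-z) = -g z) :
    ∫ z in Metric.ball 0 1, g z * γ₁ ‖z‖ = 0 := by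
  have h := integral_ball_comp_isometry γ₁ (LinearIsometryEquiv.neg ℝ) g
  simp only [LinearIsometryEquiv.coe_neg, hg, neg_mul, integral_neg] at h
  linarith

/-- Swapping two coordinates preserves the measure and the norm, so all diagonal moments agree, and
their sum is the prescribed moment `d`. Reflecting one coordinate changes the sign of an
off-diagonal moment. -/
theorem IsKernelProfile.second_moment {d : ℕ} (hd : 0 < d) {s : ℝ} (hs : s < d) {γ₁ : ℝ → ℝ}
    (hγ : IsKernelProfile d s γ₁) (i j : Fin d) :
    ∫ z : EuclideanSpace ℝ (Fin d) in Metric.ball 0 1, (z i * z j) * γ₁ ‖z‖ =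
      if i = j then 1 else 0 := by
  split_ifs with hij
  · subst hij
    have hsame : ∀ k : Fin d, ∫ z : EuclideanSpace ℝ (Fin d) in Metric.ball 0 1,
        (z k * z k) * γ₁ ‖z‖ =
        ∫ z : EuclideanSpace ℝ (Fin d) in Metric.ball 0 1, (z i * z i) * γ₁ ‖z‖ := by
      intro k
      rw [← integral_ball_comp_isometry γ₁
        (LinearIsometryEquiv.piLpCongrLeft 2 ℝ ℝ (Equiv.swap i k)) (fun z => z i * z i)]
      simp [LinearIsometryEquiv.piLpCongrLeft_apply]
    have h := hγ.moment
    have hexp : ∀ z : EuclideanSpace ℝ (Fin d), γ₁ ‖z‖ * ‖z‖ ^ 2 =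
        ∑ k : Fin d, (z k * z k) * γ₁ ‖z‖ := by
      intro z
      rw [EuclideanSpace.norm_sq_eq, ← Finset.sum_mul, mul_comm]
      simp [sq]
    simp_rw [hexp] at h
    rw [integral_finsetSum] at h
    · simp only [hsame, Finset.sum_const, Finset.card_univ, Fintype.card_fin, nsmul_eq_mul] at h
      have hd' : (d : ℝ) ≠ 0 := by positivity
      exact mul_left_cancel₀ hd' (h.trans (mul_one _).symm)
    · intro k _
      exact hγ.integrableOn_mul hd hs (g := fun z => z k * z k) (by fun_prop)
  · have h := integral_ball_comp_isometry γ₁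
      (LinearIsometryEquiv.piLpCongrRight 2 (fun k : Fin d =>
        if k = i then LinearIsometryEquiv.neg ℝ (E := ℝ) else LinearIsometryEquiv.refl ℝ ℝ))
      (fun z => z i * z j)
    simp only [LinearIsometryEquiv.piLpCongrRight_apply, if_true,
      if_neg (Ne.symm hij), LinearIsometryEquiv.coe_neg, LinearIsometryEquiv.coe_refl, id, neg_mul,
      integral_neg] at h
    linarith

/-! ### Homogeneous Taylor terms as polynomials -/

theorem multilinear_diag_eq_sum {d k : ℕ}
    (M : ContinuousMultilinearMap ℝ (fun _ : Fin k => EuclideanSpace ℝ (Fin d)) ℝ)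
    (z : EuclideanSpace ℝ (Fin d)) :
    M (fun _ => z) = ∑ r : Fin k → Fin d,
      (∏ j, z (r j)) * M (fun j => EuclideanSpace.single (r j) 1) := by
  have hz : z = ∑ i, z i • EuclideanSpace.single i (1 : ℝ) := by
    have := (EuclideanSpace.basisFun (Fin d) ℝ).sum_repr z
    simpa using this.symm
  conv_lhs => rw [hz]
  rw [M.map_sum]
  refine Finset.sum_congr rfl fun r _ => ?_
  rw [M.map_smul_univ (fun j => z (r j))]
  rfl

/-- This places the homogeneous Taylor terms of degree at most three in the space on which the
quadrature rule is exact. -/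
theorem exists_polyVal_eq_multilinear_diag {d k : ℕ}
    (M : ContinuousMultilinearMap ℝ (fun _ : Fin k => EuclideanSpace ℝ (Fin d)) ℝ) :
    ∃ p : MvPolynomial (Fin d) ℝ, p.totalDegree ≤ k ∧ ∀ z, polyVal p z = M (fun _ => z) := by
  refine ⟨∑ r : Fin k → Fin d,
    (∏ j, MvPolynomial.X (r j)) * MvPolynomial.C (M (fun j => EuclideanSpace.single (r j) 1)),
    ?_, fun z => ?_⟩
  · refine MvPolynomial.totalDegree_finsetSum_le fun r _ => ?_
    refine (MvPolynomial.totalDegree_mul _ _).trans ?_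
    rw [MvPolynomial.totalDegree_C, add_zero]
    refine (MvPolynomial.totalDegree_finsetProd _ _).trans ?_
    simp
  · rw [multilinear_diag_eq_sum, polyVal]
    simp

theorem IsKernelProfile.integral_bilinear {d : ℕ} (hd : 0 < d) {s : ℝ} (hs : s < d) {γ₁ : ℝ → ℝ}
    (hγ : IsKernelProfile d s γ₁)
    (M : ContinuousMultilinearMap ℝ (fun _ : Fin 2 => EuclideanSpace ℝ (Fin d)) ℝ) :
    ∫ z : EuclideanSpace ℝ (Fin d) in Metric.ball 0 1, M (fun _ => z) * γ₁ ‖z‖ =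
      ∑ i, M (fun _ => EuclideanSpace.single i 1) := by
  have h : ∀ z : EuclideanSpace ℝ (Fin d), M (fun _ => z) * γ₁ ‖z‖ =
      ∑ r : Fin 2 → Fin d, M (fun j => EuclideanSpace.single (r j) 1) *
        ((z (r 0) * z (r 1)) * γ₁ ‖z‖) := by
    intro z
    rw [multilinear_diag_eq_sum, Finset.sum_mul]
    refine Finset.sum_congr rfl fun r _ => ?_
    rw [Fin.prod_univ_two]
    ring
  simp_rw [h]
  rw [integral_finsetSum]
  · simp_rw [integral_const_mul, hγ.second_moment hd hs]
    -- Off-diagonal moments vanish, so only constant index pairs contribute and the trace remains.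
    rw [← Finset.sum_subset (s₁ := Finset.univ.image fun i : Fin d => fun _ : Fin 2 => i)
      (Finset.subset_univ _), Finset.sum_image]
    · simp
    · intro a _ b _ hab
      exact congrFun hab 0
    · intro r _ hr
      rw [if_neg, mul_zero]
      intro h01
      apply hr
      simp only [Finset.mem_image, Finset.mem_univ, true_and]
      refine ⟨r 0, funext fun j => ?_⟩
      fin_cases j
      · rfl
      · exact h01
  · intro r _
    exact (hγ.integrableOn_mul hd hs (g := fun z => z (r 0) * z (r 1)) (by fun_prop)).const_mul _

/-! ### The rescaled kernel -/

/-- Substitute `y = x + δz`: the volume factor `δ^d` against the prefactor `δ^{-(d+2)}` leaves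
`δ^{-2}`. -/
theorem setIntegral_ball_rescaledKernel {d : ℕ} (γ₁ : ℝ → ℝ) {δ : ℝ} (hδ : 0 < δ)
    (x : EuclideanSpace ℝ (Fin d)) (g : EuclideanSpace ℝ (Fin d) → ℝ) :
    ∫ y in Metric.ball x δ, g (y - x) * rescaledKernel d γ₁ δ ‖x - y‖ =
      1 / δ ^ 2 * ∫ z in Metric.ball 0 1, g (δ • z) * γ₁ ‖z‖ := by
  have h1 : ∫ y in Metric.ball x δ, g (y - x) * rescaledKernel d γ₁ δ ‖x - y‖ =
      ∫ z in Metric.ball 0 δ, g z * rescaledKernel d γ₁ δ ‖z‖ := by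
    have h := (measurePreserving_sub_right volume x).setIntegral_preimage_emb
      (Homeomorph.subRight x).measurableEmbedding
      (fun z => g z * rescaledKernel d γ₁ δ ‖z‖) (Metric.ball 0 δ)
    rw [← h]
    have h2 : (fun y => y - x) ⁻¹' Metric.ball 0 δ = Metric.ball x δ := by
      ext y; simp [dist_eq_norm]
    rw [h2]
    simp_rw [norm_sub_rev x]
  rw [h1]
  have h2 := Measure.setIntegral_comp_smul_of_pos volume
    (fun z : EuclideanSpace ℝ (Fin d) => g z * rescaledKernel d γ₁ δ ‖z‖) (Metric.ball 0 1) hδ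
  rw [smul_unitBall_of_pos hδ] at h2
  simp only [finrank_euclideanSpace, Fintype.card_fin, smul_eq_mul] at h2
  have h3 : ∫ z in Metric.ball 0 δ, g z * rescaledKernel d γ₁ δ ‖z‖ = δ ^ d *
      ∫ z in Metric.ball 0 1, g (δ • z) * rescaledKernel d γ₁ δ ‖δ • z‖ := by
    rw [h2]
    field_simp
  rw [h3, ← integral_const_mul, ← integral_const_mul]
  congr 1
  ext z
  rw [rescaledKernel, norm_smul, Real.norm_of_nonneg hδ.le, mul_div_cancel_left₀ _ hδ.ne', pow_add]
  field_simp

theorem rescaledKernel_of_le {d : ℕ} {s : ℝ} {γ₁ : ℝ → ℝ} (hγ : IsKernelProfile d s γ₁)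
    {δ t : ℝ} (hδ : 0 < δ) (ht : δ ≤ t) : rescaledKernel d γ₁ δ t = 0 := by
  rw [rescaledKernel, hγ.support _ ((one_le_div hδ).2 ht), mul_zero]

theorem rescaledKernel_nonneg {d : ℕ} {s : ℝ} {γ₁ : ℝ → ℝ} (hγ : IsKernelProfile d s γ₁)
    {δ t : ℝ} (hδ : 0 < δ) (ht : 0 < t) : 0 ≤ rescaledKernel d γ₁ δ t :=
  mul_nonneg (by positivity) (hγ.nonneg _ (div_pos ht hδ))

theorem IsKernelProfile.pos {d : ℕ} (hd : 0 < d) {s : ℝ} {γ₁ : ℝ → ℝ}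
    (hγ : IsKernelProfile d s γ₁) {t : ℝ} (ht : 0 < t) (ht1 : t < 1) : 0 < γ₁ t := by
  obtain ⟨-, D₀, h0, hD⟩ := hγ.exists_coeff hd
  rw [hD t ht ht1]
  exact div_pos h0 (Real.rpow_pos_of_pos ht s)

theorem rescaledKernel_pos {d : ℕ} (hd : 0 < d) {s : ℝ} {γ₁ : ℝ → ℝ}
    (hγ : IsKernelProfile d s γ₁) {δ t : ℝ} (hδ : 0 < δ) (ht : 0 < t) (htδ : t < δ) :
    0 < rescaledKernel d γ₁ δ t :=
  mul_pos (by positivity) (hγ.pos hd (div_pos ht hδ) ((div_lt_one hδ).2 htδ))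

theorem integrableOn_ball_rescaledKernel {d : ℕ} (hd : 0 < d) {s : ℝ} (hs : s < d) {γ₁ : ℝ → ℝ}
    (hγ : IsKernelProfile d s γ₁) {δ : ℝ} (hδ : 0 < δ) (x : EuclideanSpace ℝ (Fin d)) :
    IntegrableOn (fun y => rescaledKernel d γ₁ δ ‖x - y‖) (Metric.ball x δ) := by
  have h := hγ.integrableOn hd hs
  rw [← integrable_indicator_iff measurableSet_ball] at h
  have h2 := ((h.comp_smul (inv_ne_zero hδ.ne')).comp_sub_left x).const_mul (1 / δ ^ (d + 2))
  rw [← integrable_indicator_iff measurableSet_ball]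
  refine h2.congr (Filter.Eventually.of_forall fun y => ?_)
  have hn : ‖δ⁻¹ • (x - y)‖ = ‖x - y‖ / δ := by
    rw [norm_smul, norm_inv, Real.norm_of_nonneg hδ.le]; field_simp
  by_cases hy : y ∈ Metric.ball x δ
  · have h3 : δ⁻¹ • (x - y) ∈ Metric.ball (0 : EuclideanSpace ℝ (Fin d)) 1 := by
      rw [mem_ball_zero_iff, hn, div_lt_one hδ, ← dist_eq_norm, dist_comm]; exact hy
    simp only [indicator_of_mem hy, indicator_of_mem h3, hn, rescaledKernel]
  · have h3 : δ⁻¹ • (x - y) ∉ Metric.ball (0 : EuclideanSpace ℝ (Fin d)) 1 := by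
      rw [mem_ball_zero_iff, hn, div_lt_one hδ, ← dist_eq_norm, dist_comm]; exact hy
    simp only [indicator_of_notMem hy, indicator_of_notMem h3, mul_zero]

/-! ### Geometry of the extended domain -/

/-- `Metric.infDist` to the empty set is `0`, so with an empty frontier the nonlocal boundary would
be the whole complement of `Ω`. A nonempty bounded set is neither empty nor the whole space, which
rules this out. -/
theorem frontier_nonempty_of_isBounded {d : ℕ} (hd : 0 < d) {Ω : Set (EuclideanSpace ℝ (Fin d))}
    (hΩb : Bornology.IsBounded Ω) (hΩn : Ω.Nonempty) : (frontier Ω).Nonempty := by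
  have : Nonempty (Fin d) := ⟨⟨0, hd⟩⟩
  rw [nonempty_frontier_iff]
  refine ⟨hΩn, ?_⟩
  rintro rfl
  exact NormedSpace.unbounded_univ ℝ (EuclideanSpace ℝ (Fin d)) hΩb

/-- The segment from a point outside `Ω` to a point of `Ω` crosses the frontier, so being near `Ω`
and being near its frontier are the same outside `Ω`. Openness, boundedness and the inclusion of the
balls `B_δ(x)` follow. -/
theorem extendedDomain_eq_thickening {d : ℕ} (hd : 0 < d) {Ω : Set (EuclideanSpace ℝ (Fin d))}
    (hΩb : Bornology.IsBounded Ω) (hΩn : Ω.Nonempty) {δ : ℝ} (hδ : 0 < δ) :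
    extendedDomain Ω δ = Metric.thickening δ Ω := by
  have hfr := frontier_nonempty_of_isBounded hd hΩb hΩn
  ext y
  constructor
  · rintro (hy | ⟨-, hy⟩)
    · exact Metric.self_subset_thickening hδ Ω hy
    · rw [Metric.infDist_lt_iff hfr] at hy
      obtain ⟨z, hz, hyz⟩ := hy
      rw [← Metric.thickening_closure, Metric.mem_thickening_iff]
      exact ⟨z, frontier_subset_closure hz, hyz⟩
  · intro hy
    by_cases hyΩ : y ∈ Ω
    · exact Or.inl hyΩ
    · refine Or.inr ⟨hyΩ, ?_⟩
      rw [Metric.mem_thickening_iff] at hy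
      obtain ⟨x, hx, hxy⟩ := hy
      have hpre : IsPreconnected (segment ℝ y x) := (convex_segment y x).isPreconnected
      -- Otherwise the interior of `Ω` and the complement of its closure would separate the
      -- connected segment.
      have hmeet : (segment ℝ y x ∩ frontier Ω).Nonempty := by
        by_contra! hemp
        have hnf : ∀ z ∈ segment ℝ y x, z ∉ frontier Ω := fun z hz hzf =>
          (hemp.subset ⟨hz, hzf⟩ : z ∈ (∅ : Set _))
        have hcl : ∀ z ∈ segment ℝ y x, z ∉ interior Ω → z ∉ closure Ω :=
          fun z hz hzi hzc => hnf z hz ⟨hzc, hzi⟩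
        obtain ⟨z, -, hz1, hz2⟩ := hpre (interior Ω) (closure Ω)ᶜ isOpen_interior
          isClosed_closure.isOpen_compl
          (fun z hz => (em (z ∈ interior Ω)).imp id (hcl z hz))
          ⟨x, right_mem_segment ℝ y x, by
            by_contra h
            exact hcl x (right_mem_segment ℝ y x) h (subset_closure hx)⟩
          ⟨y, left_mem_segment ℝ y x, hcl y (left_mem_segment ℝ y x)
            fun h => hyΩ (interior_subset h)⟩
        exact hz2 (interior_subset_closure hz1)
      obtain ⟨z, hz, hzf⟩ := hmeet
      rw [Metric.infDist_lt_iff hfr]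
      refine ⟨z, hzf, lt_of_le_of_lt ?_ hxy⟩
      have := segment_subset_closedBall_left y x hz
      rw [dist_comm]
      simpa using this

theorem isOpen_extendedDomain {d : ℕ} (hd : 0 < d) {Ω : Set (EuclideanSpace ℝ (Fin d))}
    (hΩb : Bornology.IsBounded Ω) (hΩn : Ω.Nonempty) {δ : ℝ} (hδ : 0 < δ) :
    IsOpen (extendedDomain Ω δ) := by
  rw [extendedDomain_eq_thickening hd hΩb hΩn hδ]
  exact Metric.isOpen_thickening

theorem ball_subset_extendedDomain {d : ℕ} (hd : 0 < d) {Ω : Set (EuclideanSpace ℝ (Fin d))}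
    (hΩb : Bornology.IsBounded Ω) (hΩn : Ω.Nonempty) {δ : ℝ} (hδ : 0 < δ)
    {x : EuclideanSpace ℝ (Fin d)} (hx : x ∈ Ω) : Metric.ball x δ ⊆ extendedDomain Ω δ := by
  rw [extendedDomain_eq_thickening hd hΩb hΩn hδ]
  exact Metric.ball_subset_thickening hx δ

theorem nonlocalBoundary_mono {d : ℕ} {Ω : Set (EuclideanSpace ℝ (Fin d))} {δ δ' : ℝ}
    (h : δ ≤ δ') : nonlocalBoundary Ω δ ⊆ nonlocalBoundary Ω δ' :=
  fun _ hx => ⟨hx.1, hx.2.trans_le h⟩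

theorem extendedDomain_mono {d : ℕ} {Ω : Set (EuclideanSpace ℝ (Fin d))} {δ δ' : ℝ}
    (h : δ ≤ δ') : extendedDomain Ω δ ⊆ extendedDomain Ω δ' :=
  union_subset_union_right _ (nonlocalBoundary_mono h)

theorem isBounded_extendedDomain {d : ℕ} (hd : 0 < d) {Ω : Set (EuclideanSpace ℝ (Fin d))}
    (hΩb : Bornology.IsBounded Ω) (hΩn : Ω.Nonempty) {δ : ℝ} (hδ : 0 < δ) :
    Bornology.IsBounded (extendedDomain Ω δ) := by
  rw [extendedDomain_eq_thickening hd hΩb hΩn hδ]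
  exact hΩb.thickening

/-! ### Lattice, grid and stencil -/

/-- The lattice vector `k` as a point of Euclidean space. -/
def latticePoint {d : ℕ} (k : Fin d → ℤ) : EuclideanSpace ℝ (Fin d) :=
  WithLp.toLp 2 fun i => (k i : ℝ)

@[simp] theorem latticePoint_apply {d : ℕ} (k : Fin d → ℤ) (i : Fin d) :
    latticePoint k i = k i := rfl

theorem latticePoint_injective {d : ℕ} : Function.Injective (latticePoint (d := d)) := by
  intro k l h
  funext i
  have := congrArg (fun z : EuclideanSpace ℝ (Fin d) => z i) h
  simpa using this

theorem finite_lattice_inter {d : ℕ} {S : Set (EuclideanSpace ℝ (Fin d))}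
    (hS : Bornology.IsBounded S) {h : ℝ} (hh : 0 < h) :
    {k : Fin d → ℤ | h • latticePoint k ∈ S}.Finite := by
  obtain ⟨R, hR⟩ := hS.exists_norm_le
  refine (Set.Finite.pi (t := fun _ : Fin d => Set.Icc (-⌈R / h⌉) ⌈R / h⌉)
    (fun _ => Set.finite_Icc _ _)).subset ?_
  intro k hk
  simp only [Set.mem_pi, Set.mem_univ, true_imp_iff, Set.mem_Icc, ← abs_le]
  intro i
  have h1 := (PiLp.norm_apply_le (h • latticePoint k) i).trans (hR _ hk)
  simp only [PiLp.smul_apply, latticePoint_apply, smul_eq_mul, norm_mul, Real.norm_eq_abs,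
    abs_of_pos hh] at h1
  have h2 : |(k i : ℝ)| ≤ R / h := by rw [le_div_iff₀ hh, mul_comm]; exact h1
  have h3 := h2.trans (Int.le_ceil _)
  exact_mod_cast h3

theorem mem_grid_iff {d : ℕ} {Ω : Set (EuclideanSpace ℝ (Fin d))} {δ h : ℝ}
    {x : EuclideanSpace ℝ (Fin d)} :
    x ∈ grid Ω δ h ↔ (∃ k, x = h • latticePoint k) ∧ x ∈ extendedDomain Ω δ := by
  refine and_congr_left fun _ => exists_congr fun k => ?_
  constructor
  · intro hk
    ext i
    simp [hk i, mul_comm]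
  · rintro rfl i
    simp [mul_comm]

theorem finite_grid {d : ℕ} (hd : 0 < d) {Ω : Set (EuclideanSpace ℝ (Fin d))}
    (hΩb : Bornology.IsBounded Ω) (hΩn : Ω.Nonempty) {δ h : ℝ} (hδ : 0 < δ) (hh : 0 < h) :
    (grid Ω δ h).Finite := by
  refine ((finite_lattice_inter (isBounded_extendedDomain hd hΩb hΩn hδ) hh).image
    fun k => h • latticePoint k).subset ?_
  intro x hx
  obtain ⟨⟨k, rfl⟩, hk⟩ := mem_grid_iff.1 hx
  exact ⟨k, hk, rfl⟩

theorem neighbors_subset_grid {d : ℕ} {Ω : Set (EuclideanSpace ℝ (Fin d))} {δ h : ℝ}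
    {x : EuclideanSpace ℝ (Fin d)} : neighbors Ω δ h x ⊆ grid Ω δ h :=
  fun _ hy => hy.1.1

/-- The nonzero lattice vectors `k` with `|ε k| < 1`. -/
def latticeStencil (d : ℕ) (ε : ℝ) : Set (Fin d → ℤ) :=
  {k | k ≠ 0 ∧ ‖ε • latticePoint k‖ < 1}

theorem finite_latticeStencil (d : ℕ) {ε : ℝ} (hε : 0 < ε) : (latticeStencil d ε).Finite := by
  refine (finite_lattice_inter (S := Metric.ball 0 1) Metric.isBounded_ball hε).subset ?_
  intro k hk
  simpa using hk.2

/-- The centre is itself a lattice point and the whole ball around it lies in the extended domain,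
so the stencil is never truncated. After scaling by `δ` it depends on `h / δ` alone, which makes one
positivity constant serve all `δ` and `x`. -/
theorem neighbors_eq_image {d : ℕ} (hd : 0 < d) {Ω : Set (EuclideanSpace ℝ (Fin d))}
    (hΩb : Bornology.IsBounded Ω) (hΩn : Ω.Nonempty) {δ h : ℝ} (hδ : 0 < δ) (hh : 0 < h)
    {x : EuclideanSpace ℝ (Fin d)} (hx : x ∈ grid Ω δ h ∩ Ω) :
    neighbors Ω δ h x =
      (fun k => x + δ • ((h / δ) • latticePoint k)) '' latticeStencil d (h / δ) := by
  have hsm : ∀ k : Fin d → ℤ, δ • ((h / δ) • latticePoint k) = h • latticePoint k := by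
    intro k
    rw [smul_smul, mul_div_cancel₀ _ hδ.ne']
  obtain ⟨⟨k₀, hk₀⟩, -⟩ := mem_grid_iff.1 hx.1
  ext y
  constructor
  · rintro ⟨⟨hyg, hyb⟩, hyx⟩
    obtain ⟨⟨k, rfl⟩, -⟩ := mem_grid_iff.1 hyg
    have hsub : latticePoint (k - k₀) = latticePoint k - latticePoint k₀ := by
      ext i; simp
    refine ⟨k - k₀, ⟨?_, ?_⟩, ?_⟩
    · intro h0
      rw [sub_eq_zero] at h0
      subst h0
      exact hyx hk₀.symm
    · rw [Metric.mem_ball, dist_eq_norm, hk₀, ← smul_sub, ← hsub, ← hsm, norm_smul,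
        Real.norm_of_nonneg hδ.le] at hyb
      nlinarith
    · change x + δ • ((h / δ) • latticePoint (k - k₀)) = _
      rw [hsm, hsub, hk₀]
      module
  · rintro ⟨k, ⟨hk0, hk1⟩, rfl⟩
    simp only [hsm]
    have hb : x + h • latticePoint k ∈ Metric.ball x δ := by
      rw [Metric.mem_ball, dist_eq_norm, add_sub_cancel_left, ← hsm, norm_smul,
        Real.norm_of_nonneg hδ.le]
      nlinarith
    refine ⟨⟨mem_grid_iff.2 ⟨⟨k₀ + k, ?_⟩, ball_subset_extendedDomain hd hΩb hΩn hδ hx.2 hb⟩, hb⟩, ?_⟩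
    · rw [hk₀, ← smul_add]
      congr 1
      ext i
      simp
    · intro h0
      have h1 : h • latticePoint k = 0 := by simpa using h0
      rw [smul_eq_zero] at h1
      rcases h1 with h1 | h1
      · exact hh.ne' h1
      · exact hk0 (latticePoint_injective (h1.trans (by ext i; simp)))

/-! ### Calculus of `C⁴` bounds and Taylor expansion -/

theorem HasC4Bound.nonneg_of_mem {d : ℕ} {U : Set (EuclideanSpace ℝ (Fin d))} {K : ℝ}
    {u : EuclideanSpace ℝ (Fin d) → ℝ} (h : HasC4Bound U K u) {x : EuclideanSpace ℝ (Fin d)}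
    (hx : x ∈ U) : 0 ≤ K :=
  (norm_nonneg _).trans (h.2 0 (by norm_num) x hx)

theorem HasC4Bound.abs_le {d : ℕ} {U : Set (EuclideanSpace ℝ (Fin d))} {K : ℝ}
    {u : EuclideanSpace ℝ (Fin d) → ℝ} (h : HasC4Bound U K u) {x : EuclideanSpace ℝ (Fin d)}
    (hx : x ∈ U) : |u x| ≤ K := by
  simpa using h.2 0 (by norm_num) x hx

theorem HasC4Bound.contDiffAt {d : ℕ} {U : Set (EuclideanSpace ℝ (Fin d))} (hU : IsOpen U) {K : ℝ}
    {u : EuclideanSpace ℝ (Fin d) → ℝ} (h : HasC4Bound U K u) {x : EuclideanSpace ℝ (Fin d)}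
    (hx : x ∈ U) : ContDiffAt ℝ 4 u x :=
  h.1.contDiffAt (hU.mem_nhds hx)

theorem HasC4Bound.norm_iteratedFDeriv_le {d : ℕ} {U : Set (EuclideanSpace ℝ (Fin d))}
    (hU : IsOpen U) {K : ℝ} {u : EuclideanSpace ℝ (Fin d) → ℝ} (h : HasC4Bound U K u) {k : ℕ}
    (hk : k ≤ 4) {x : EuclideanSpace ℝ (Fin d)} (hx : x ∈ U) : ‖iteratedFDeriv ℝ k u x‖ ≤ K := by
  rw [← iteratedFDerivWithin_of_isOpen k hU hx]
  exact h.2 k hk x hx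

/-- The subtracted constant affects only the derivative of order zero, whose bound at most doubles.
-/
theorem HasC4Bound.sub_const {d : ℕ} {U : Set (EuclideanSpace ℝ (Fin d))} (hU : IsOpen U) {K : ℝ}
    {u : EuclideanSpace ℝ (Fin d) → ℝ} (h : HasC4Bound U K u) {x₀ : EuclideanSpace ℝ (Fin d)}
    (hx₀ : x₀ ∈ U) : HasC4Bound U (2 * K) fun x => u x - u x₀ := by
  have hK := h.nonneg_of_mem hx₀
  refine ⟨h.1.sub contDiffOn_const, fun k hk x hx => ?_⟩
  rcases k with _ | k
  · rw [norm_iteratedFDerivWithin_zero, Real.norm_eq_abs]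
    have h1 := abs_sub (u x) (u x₀)
    have h2 := h.abs_le hx
    have h3 := h.abs_le hx₀
    linarith
  · have h1 : iteratedFDerivWithin ℝ (k + 1) (fun x => u x - u x₀) U x =
        iteratedFDerivWithin ℝ (k + 1) u U x := by
      have h2 := iteratedFDerivWithin_sub_apply (i := k + 1) (f := u) (g := fun _ => u x₀)
        ((h.1 x hx).of_le (by exact_mod_cast hk)) contDiffWithinAt_const hU.uniqueDiffOn hx
      rw [iteratedFDerivWithin_const_of_ne (by omega)] at h2
      rw [show (fun x => u x - u x₀) = u - fun _ => u x₀ from rfl, h2]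
      simp
    rw [h1]
    linarith [h.2 (k + 1) hk x hx]

/-- By the Leibniz rule the binomial coefficients of order `k ≤ 4` add up to `2 ^ k ≤ 16`. -/
theorem HasC4Bound.mul {d : ℕ} {U : Set (EuclideanSpace ℝ (Fin d))} (hU : IsOpen U) {K K' : ℝ}
    {u v : EuclideanSpace ℝ (Fin d) → ℝ} (hu : HasC4Bound U K u) (hv : HasC4Bound U K' v) :
    HasC4Bound U (16 * K * K') fun x => u x * v x := by
  refine ⟨hu.1.mul hv.1, fun k hk x hx => ?_⟩
  have hK := hu.nonneg_of_mem hx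
  have hK' := hv.nonneg_of_mem hx
  have h1 := norm_iteratedFDerivWithin_mul_le hu.1 hv.1 hU.uniqueDiffOn hx (n := k)
    (by exact_mod_cast hk)
  refine h1.trans ?_
  calc _ ≤ ∑ i ∈ Finset.range (k + 1), (k.choose i : ℝ) * (K * K') := by
        refine Finset.sum_le_sum fun i hi => ?_
        rw [mul_assoc]
        refine mul_le_mul_of_nonneg_left ?_ (by positivity)
        exact mul_le_mul (hu.2 i (by have := Finset.mem_range.1 hi; omega) x hx)
          (hv.2 _ (by omega) x hx) (norm_nonneg _) hK
    _ = 2 ^ k * (K * K') := by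
        rw [← Finset.sum_mul, ← Nat.cast_sum, Nat.sum_range_choose]
        push_cast
        ring
    _ ≤ 2 ^ 4 * (K * K') := by
        refine mul_le_mul_of_nonneg_right (pow_le_pow_right₀ (by norm_num) hk) (by positivity)
    _ = _ := by ring

theorem isC4_of_contDiff {d : ℕ} {U : Set (EuclideanSpace ℝ (Fin d))} (hU : IsOpen U)
    (hUb : Bornology.IsBounded U) {u : EuclideanSpace ℝ (Fin d) → ℝ} (hu : ContDiff ℝ 4 u) :
    IsC4 U u := by
  have hc : IsCompact (closure U) := hUb.isCompact_closure
  have h : ∀ k : ℕ, ∃ C : ℝ, k ≤ 4 → ∀ x ∈ U, ‖iteratedFDeriv ℝ k u x‖ ≤ C := by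
    intro k
    by_cases hk : k ≤ 4
    · obtain ⟨C, hC⟩ := hc.exists_bound_of_continuousOn
        (hu.continuous_iteratedFDeriv (m := k) (by exact_mod_cast hk)).continuousOn
      exact ⟨C, fun _ x hx => hC x (subset_closure hx)⟩
    · exact ⟨0, fun h => absurd h hk⟩
  choose C hC using h
  refine ⟨∑ k ∈ Finset.range 5, |C k|, hu.contDiffOn, fun k hk x hx => ?_⟩
  rw [iteratedFDerivWithin_of_isOpen k hU hx]
  refine (hC k hk x hx).trans ((le_abs_self _).trans ?_)
  exact Finset.single_le_sum (f := fun k => |C k|) (fun _ _ => abs_nonneg _)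
    (Finset.mem_range.2 (by omega))

/-- Taylor's formula with integral remainder along the segment from `x` to `y`. The factors `1 / 3!`
and `(1 - t) ^ 3` are merely bounded by one, as the size of the constant is immaterial. -/
theorem abs_sub_taylor_three_le {E : Type*} [NormedAddCommGroup E] [NormedSpace ℝ E] {f : E → ℝ}
    {x : E} {δ K : ℝ} (hf : ∀ y ∈ Metric.ball x δ, ContDiffAt ℝ 4 f y)
    (hK : ∀ y ∈ Metric.ball x δ, ‖iteratedFDeriv ℝ 4 f y‖ ≤ K) {y : E}
    (hy : y ∈ Metric.ball x δ) :
    |f y - ∑ k ∈ Finset.range 4, (k.factorial : ℝ)⁻¹ * iteratedFDeriv ℝ k f x (fun _ => y - x)| ≤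
      K * ‖y - x‖ ^ 4 := by
  have hδ : 0 < δ := Metric.pos_of_mem_ball hy
  have hmem : ∀ t ∈ Icc (0 : ℝ) 1, x + t • (y - x) ∈ Metric.ball x δ := by
    intro t ht
    exact (convex_ball x δ).add_smul_sub_mem (Metric.mem_ball_self hδ) hy ht
  have h := map_add_eq_sum_add_integral_iteratedFDeriv (n := 3) (f := f) (x := x) (y := y - x)
    (fun t ht => by norm_num; exact hf _ (hmem t ht))
  rw [add_sub_cancel] at h
  simp only [smul_eq_mul] at h
  have h2 : ‖∫ t in (0 : ℝ)..1, (1 - t) ^ 3 *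
      iteratedFDeriv ℝ (3 + 1) f (x + t • (y - x)) (fun _ => y - x)‖ ≤
      (K * ‖y - x‖ ^ 4) * |(1 : ℝ) - 0| := by
    refine intervalIntegral.norm_integral_le_of_norm_le_const fun t ht => ?_
    rw [uIoc_of_le zero_le_one] at ht
    rw [norm_mul]
    have h3 : ‖iteratedFDeriv ℝ (3 + 1) f (x + t • (y - x)) (fun _ => y - x)‖ ≤
        K * ‖y - x‖ ^ 4 := by
      refine (ContinuousMultilinearMap.le_opNorm _ _).trans ?_
      simp only [Finset.prod_const, Finset.card_univ, Fintype.card_fin]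
      exact mul_le_mul_of_nonneg_right (hK _ (hmem t ⟨ht.1.le, ht.2⟩)) (by positivity)
    have h4 : ‖(1 - t) ^ 3‖ ≤ 1 := by
      rw [norm_pow]
      refine pow_le_one₀ (norm_nonneg _) ?_
      rw [Real.norm_eq_abs, abs_le]
      constructor <;> linarith [ht.1, ht.2]
    calc _ ≤ 1 * (K * ‖y - x‖ ^ 4) := mul_le_mul h4 h3 (norm_nonneg _) zero_le_one
      _ = _ := one_mul _
  rw [h, add_sub_cancel_left, abs_mul]
  have h5 : |((Nat.factorial 3 : ℕ) : ℝ)⁻¹| ≤ 1 := by norm_num [Nat.factorial]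
  rw [Real.norm_eq_abs, sub_zero, abs_one, mul_one] at h2
  calc _ ≤ 1 * (K * ‖y - x‖ ^ 4) := mul_le_mul h5 h2 (abs_nonneg _) zero_le_one
    _ = _ := one_mul _

theorem multilinear_smul_diag {E : Type*} [NormedAddCommGroup E] [NormedSpace ℝ E] {k : ℕ}
    (M : ContinuousMultilinearMap ℝ (fun _ : Fin k => E) ℝ) (c : ℝ) (z : E) :
    M (fun _ => c • z) = c ^ k * M (fun _ => z) := by
  have := M.map_smul_univ (fun _ => c) (fun _ => z)
  simpa using this

theorem multilinear_diag_integral_odd {d k : ℕ} (hk : Odd k) (γ₁ : ℝ → ℝ)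
    (M : ContinuousMultilinearMap ℝ (fun _ : Fin k => EuclideanSpace ℝ (Fin d)) ℝ) :
    ∫ z in Metric.ball 0 1, M (fun _ => z) * γ₁ ‖z‖ = 0 := by
  refine integral_ball_odd γ₁ (fun z => M (fun _ => z)) fun z => ?_
  have := multilinear_smul_diag M (-1) z
  rw [hk.neg_one_pow] at this
  simpa using this

/-- The degree three Taylor polynomial of a function vanishing at `x`, together with the
value of its integral against the rescaled kernel. -/
theorem exists_taylor_polynomial {d : ℕ} (hd : 0 < d) {s : ℝ} (hs : s < d) {γ₁ : ℝ → ℝ}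
    (hγ : IsKernelProfile d s γ₁) {f : EuclideanSpace ℝ (Fin d) → ℝ}
    {x : EuclideanSpace ℝ (Fin d)} {δ K : ℝ} (hδ : 0 < δ)
    (hf : ∀ y ∈ Metric.ball x δ, ContDiffAt ℝ 4 f y)
    (hK : ∀ y ∈ Metric.ball x δ, ‖iteratedFDeriv ℝ 4 f y‖ ≤ K) (hx : f x = 0) :
    ∃ p : MvPolynomial (Fin d) ℝ, p.totalDegree ≤ 3 ∧
      (∀ y ∈ Metric.ball x δ, |f y - polyVal p (y - x)| ≤ K * ‖y - x‖ ^ 4) ∧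
      2 * ∫ y in Metric.ball x δ, polyVal p (y - x) * rescaledKernel d γ₁ δ ‖x - y‖ =
        ∑ i, iteratedFDeriv ℝ 2 f x (fun _ => EuclideanSpace.single i 1) := by
  choose p hpdeg hpval using fun k : ℕ => exists_polyVal_eq_multilinear_diag (iteratedFDeriv ℝ k f x)
  -- There is no constant term because `f x = 0`.
  have hsum : ∀ z, polyVal (p 1 + MvPolynomial.C (1 / 2) * p 2 + MvPolynomial.C (1 / 6) * p 3) z =
      iteratedFDeriv ℝ 1 f x (fun _ => z) + 1 / 2 * iteratedFDeriv ℝ 2 f x (fun _ => z) +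
        1 / 6 * iteratedFDeriv ℝ 3 f x (fun _ => z) := by
    intro z
    simp only [← hpval, polyVal, map_add, map_mul, MvPolynomial.eval_C]
  refine ⟨p 1 + MvPolynomial.C (1 / 2) * p 2 + MvPolynomial.C (1 / 6) * p 3, ?_, fun y hy => ?_, ?_⟩
  · have hC : ∀ (c : ℝ) k, (MvPolynomial.C c * p k).totalDegree ≤ k := by
      intro c k
      refine (MvPolynomial.totalDegree_mul _ _).trans ?_
      rw [MvPolynomial.totalDegree_C, zero_add]
      exact hpdeg k
    refine (MvPolynomial.totalDegree_add _ _).trans (max_le ((MvPolynomial.totalDegree_add _ _).trans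
      (max_le ((hpdeg 1).trans (by norm_num)) ((hC _ _).trans (by norm_num)))) (hC _ _))
  · have h := abs_sub_taylor_three_le hf hK hy
    rw [hsum]
    simp only [Finset.sum_range_succ, Finset.sum_range_zero, iteratedFDeriv_zero_apply, hx,
      Nat.factorial] at h
    norm_num at h ⊢
    exact h
  · rw [setIntegral_ball_rescaledKernel γ₁ hδ x]
    have hM : ∀ k : ℕ, IntegrableOn (fun z : EuclideanSpace ℝ (Fin d) =>
        iteratedFDeriv ℝ k f x (fun _ => z) * γ₁ ‖z‖) (Metric.ball 0 1) := fun k =>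
      hγ.integrableOn_mul hd hs ((iteratedFDeriv ℝ k f x).cont.comp (by fun_prop))
    have hsplit : ∀ z : EuclideanSpace ℝ (Fin d),
        polyVal (p 1 + MvPolynomial.C (1 / 2) * p 2 + MvPolynomial.C (1 / 6) * p 3) (δ • z) * γ₁ ‖z‖
        = δ * (iteratedFDeriv ℝ 1 f x (fun _ => z) * γ₁ ‖z‖) +
          δ ^ 2 / 2 * (iteratedFDeriv ℝ 2 f x (fun _ => z) * γ₁ ‖z‖) +
          δ ^ 3 / 6 * (iteratedFDeriv ℝ 3 f x (fun _ => z) * γ₁ ‖z‖) := by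
      intro z
      rw [hsum]
      simp only [multilinear_smul_diag]
      ring
    simp_rw [hsplit]
    -- The terms of degree one and three vanish by parity. The factor `δ ^ 2 / 2` of the quadratic
    -- term cancels against `1 / δ ^ 2` and the leading `2`, leaving the trace.
    rw [integral_add, integral_add, integral_const_mul,
      integral_const_mul, integral_const_mul, multilinear_diag_integral_odd (k := 1) (by decide),
      multilinear_diag_integral_odd (k := 3) (by decide), hγ.integral_bilinear hd hs]
    · field_simp
      ring
    · exact (hM 1).const_mul _
    · exact (hM 2).const_mul _
    · exact ((hM 1).const_mul _).add ((hM 2).const_mul _)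
    · exact (hM 3).const_mul _

/-! ### Riemann sums for the singular kernel -/

/-- The discarded null sets are the singularity of the kernel and the sphere where it may jump.
Pointwise convergence of the Riemann sums is checked off them. -/
theorem ae_ne_zero_and_norm_ne_one {d : ℕ} (hd : 0 < d) :
    ∀ᵐ y : EuclideanSpace ℝ (Fin d), y ≠ 0 ∧ ‖y‖ ≠ 1 := by
  have : Nonempty (Fin d) := ⟨⟨0, hd⟩⟩
  have h0 : ∀ᵐ z : EuclideanSpace ℝ (Fin d), z ≠ 0 := by simp [ae_iff]
  have h1 : ∀ᵐ z : EuclideanSpace ℝ (Fin d), ‖z‖ ≠ 1 := by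
    have := Measure.addHaar_sphere (volume : Measure (EuclideanSpace ℝ (Fin d))) 0 1
    rw [ae_iff]
    convert this using 2
    ext; simp
  exact h0.and h1

/-- The index of the lattice cell of size `ε` that contains `y`. -/
noncomputable def cellIndex {d : ℕ} (ε : ℝ) (y : EuclideanSpace ℝ (Fin d)) : Fin d → ℤ :=
  fun i => ⌊y i / ε⌋

theorem measurable_cellIndex {d : ℕ} (ε : ℝ) :
    Measurable (cellIndex ε : EuclideanSpace ℝ (Fin d) → Fin d → ℤ) := by
  refine measurable_pi_lambda _ fun i => ?_
  refine Int.measurable_floor.comp ?_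
  fun_prop

theorem volume_cell {d : ℕ} {ε : ℝ} (hε : 0 < ε) (k : Fin d → ℤ) :
    volume (cellIndex ε ⁻¹' {k} : Set (EuclideanSpace ℝ (Fin d))) = ENNReal.ofReal (ε ^ d) := by
  have h : (cellIndex ε ⁻¹' {k} : Set (EuclideanSpace ℝ (Fin d))) =
      (WithLp.ofLp) ⁻¹' (Set.pi univ fun i => Ico (k i * ε) (k i * ε + ε)) := by
    ext y
    simp only [mem_preimage, mem_singleton_iff, Set.mem_pi, mem_univ, true_imp_iff, mem_Ico,
      funext_iff, cellIndex, Int.floor_eq_iff]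
    refine forall_congr' fun i => ?_
    rw [le_div_iff₀ hε, div_lt_iff₀ hε, add_mul, one_mul]
  rw [h, (PiLp.volume_preserving_ofLp (Fin d)).measure_preimage
    (MeasurableSet.univ_pi fun i => measurableSet_Ico).nullMeasurableSet, Real.volume_pi_Ico]
  simp [ENNReal.ofReal_pow hε.le]

theorem integral_cellwise {d : ℕ} {ε : ℝ} (hε : 0 < ε) (T : Finset (Fin d → ℤ))
    (c : (Fin d → ℤ) → ℝ) :
    ∫ y : EuclideanSpace ℝ (Fin d), ∑ k ∈ T, (cellIndex ε ⁻¹' {k}).indicator (fun _ => c k) y =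
      ε ^ d * ∑ k ∈ T, c k := by
  have hm : ∀ k : Fin d → ℤ,
      MeasurableSet (cellIndex ε ⁻¹' {k} : Set (EuclideanSpace ℝ (Fin d))) := fun k =>
    measurable_cellIndex ε (measurableSet_singleton k)
  rw [integral_finsetSum]
  · rw [Finset.mul_sum]
    refine Finset.sum_congr rfl fun k _ => ?_
    rw [integral_indicator_const (c k) (hm k), Measure.real, volume_cell hε,
      ENNReal.toReal_ofReal (by positivity), smul_eq_mul]
  · intro k _
    refine (integrable_indicator_iff (hm k)).2 (integrableOn_const (by simp [volume_cell hε]))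

theorem sum_cell_indicator {d : ℕ} {ε : ℝ} (T : Finset (Fin d → ℤ))
    (c : (Fin d → ℤ) → ℝ) (y : EuclideanSpace ℝ (Fin d)) :
    ∑ k ∈ T, (cellIndex ε ⁻¹' {k}).indicator (fun _ => c k) y =
      if cellIndex ε y ∈ T then c (cellIndex ε y) else 0 := by
  classical
  simp [indicator_apply, Finset.sum_ite_eq]

theorem norm_le_of_abs_apply_le {d : ℕ} {ε : ℝ} (hε : 0 ≤ ε) {z : EuclideanSpace ℝ (Fin d)}
    (hz : ∀ i, |z i| ≤ ε) : ‖z‖ ≤ d * ε := by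
  have hn : ‖z‖ ^ 2 ≤ (d * ε) ^ 2 := by
    rw [EuclideanSpace.norm_sq_eq]
    calc _ ≤ ∑ _i : Fin d, ε ^ 2 := by
          refine Finset.sum_le_sum fun i _ => ?_
          rw [Real.norm_eq_abs]
          exact pow_le_pow_left₀ (abs_nonneg _) (hz i) 2
      _ = d * ε ^ 2 := by simp
      _ ≤ _ := by
          rw [mul_pow]
          refine mul_le_mul_of_nonneg_right ?_ (by positivity)
          exact_mod_cast Nat.le_self_pow two_ne_zero d
  exact le_of_sq_le_sq hn (by positivity)

theorem norm_sub_cell_le {d : ℕ} {ε : ℝ} (hε : 0 < ε) (y : EuclideanSpace ℝ (Fin d)) :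
    ‖y - ε • latticePoint (cellIndex ε y)‖ ≤ d * ε := by
  refine norm_le_of_abs_apply_le hε.le fun i => ?_
  have h1 := Int.floor_le (y i / ε)
  have h2 := Int.lt_floor_add_one (y i / ε)
  rw [le_div_iff₀ hε] at h1
  rw [div_lt_iff₀ hε] at h2
  simp only [PiLp.sub_apply, PiLp.smul_apply, latticePoint_apply, smul_eq_mul, cellIndex]
  rw [abs_le]
  constructor <;> nlinarith

theorem le_norm_smul_latticePoint {d : ℕ} {ε : ℝ} (hε : 0 < ε) {k : Fin d → ℤ} (hk : k ≠ 0) :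
    ε ≤ ‖ε • latticePoint k‖ := by
  obtain ⟨i, hi⟩ := Function.ne_iff.1 hk
  have h1 := PiLp.norm_apply_le (ε • latticePoint k) i
  simp only [PiLp.smul_apply, latticePoint_apply, smul_eq_mul, norm_mul, Real.norm_eq_abs,
    abs_of_pos hε] at h1
  have h2 : (1 : ℝ) ≤ |(k i : ℝ)| := by exact_mod_cast Int.one_le_abs hi
  nlinarith

open Filter Topology in
theorem tendsto_cell {d : ℕ} (y : EuclideanSpace ℝ (Fin d)) :
    Tendsto (fun ε : ℝ => ε • latticePoint (cellIndex ε y)) (𝓝[>] 0) (𝓝 y) := by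
  rw [tendsto_iff_norm_sub_tendsto_zero]
  have h0 : Tendsto (fun ε : ℝ => d * ε) (𝓝[>] 0) (𝓝 0) := by
    have : Tendsto (fun ε : ℝ => (d : ℝ) * ε) (𝓝 0) (𝓝 (d * 0)) := tendsto_id.const_mul _
    rw [mul_zero] at this
    exact this.mono_left nhdsWithin_le_nhds
  refine tendsto_of_tendsto_of_tendsto_of_le_of_le' tendsto_const_nhds h0
    (Eventually.of_forall fun _ => norm_nonneg _) ?_
  filter_upwards [self_mem_nhdsWithin] with ε hε
  rw [norm_sub_rev]
  exact norm_sub_cell_le hε y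

open Filter Topology in
/-- Riemann sums over the punctured lattice converge for the singular integrable kernel. -/
theorem tendsto_lattice_sum {d : ℕ} (hd : 0 < d) {s : ℝ} (hs : s < d) {γ₁ : ℝ → ℝ}
    (hγ : IsKernelProfile d s γ₁) {g : EuclideanSpace ℝ (Fin d) → ℝ} (hg : Continuous g) :
    Tendsto (fun ε : ℝ => ε ^ d * ∑ᶠ k ∈ latticeStencil d ε,
        g (ε • latticePoint k) * γ₁ ‖ε • latticePoint k‖) (𝓝[>] 0)
      (𝓝 (∫ z in Metric.ball 0 1, g z * γ₁ ‖z‖)) := by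
  classical
  obtain ⟨hs0, D₀, hD0, hD⟩ := hγ.exists_coeff hd
  obtain ⟨B, hB⟩ := (isCompact_closedBall (0 : EuclideanSpace ℝ (Fin d)) 1).exists_bound_of_continuousOn
    hg.continuousOn
  have hB0 : 0 ≤ B := (norm_nonneg _).trans (hB 0 (by simp))
  let c : ℝ → (Fin d → ℤ) → ℝ := fun ε k => g (ε • latticePoint k) * γ₁ ‖ε • latticePoint k‖
  -- The Riemann sum is the integral of a step function that takes on each cell the value at its
  -- corner, and zero if the corner is outside the stencil. Convergence of sums thus becomes
  -- dominated convergence.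
  let Φ : ℝ → EuclideanSpace ℝ (Fin d) → ℝ := fun ε y =>
    if cellIndex ε y ∈ latticeStencil d ε then c ε (cellIndex ε y) else 0
  have hΦ : ∀ ε : ℝ, (hε : 0 < ε) → ∀ y, Φ ε y = ∑ k ∈ (finite_latticeStencil d hε).toFinset,
      (cellIndex ε ⁻¹' {k}).indicator (fun _ => c ε k) y := by
    intro ε hε y
    rw [sum_cell_indicator]
    simp [Φ]
  have hint : ∀ᶠ ε in 𝓝[>] (0 : ℝ), ∫ y, Φ ε y = ε ^ d * ∑ᶠ k ∈ latticeStencil d ε,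
      g (ε • latticePoint k) * γ₁ ‖ε • latticePoint k‖ := by
    filter_upwards [self_mem_nhdsWithin] with ε hε
    simp_rw [hΦ ε hε]
    rw [integral_cellwise hε, finsum_mem_eq_finite_toFinset_sum _ (finite_latticeStencil d hε)]
  refine Tendsto.congr' hint ?_
  rw [← integral_indicator measurableSet_ball]
  refine tendsto_integral_filter_of_dominated_convergence
    ((Metric.ball 0 (1 + d)).indicator fun y => B * (D₀ * (1 + d) ^ s) * ‖y‖ ^ (-s)) ?_ ?_ ?_ ?_
  · filter_upwards [self_mem_nhdsWithin] with ε hε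
    refine Measurable.aestronglyMeasurable ?_
    rw [funext (hΦ ε hε)]
    exact Finset.measurable_fun_sum _ fun k _ =>
      measurable_const.indicator (measurable_cellIndex ε (measurableSet_singleton k))
  · have h1 : ∀ᶠ ε in 𝓝[>] (0 : ℝ), ε < 1 := nhdsWithin_le_nhds (gt_mem_nhds one_pos)
    filter_upwards [self_mem_nhdsWithin, h1] with ε (hε : 0 < ε) hε1
    filter_upwards [ae_ne_zero_and_norm_ne_one hd] with y hy
    have hpos : 0 ≤ B * (D₀ * (1 + d) ^ s) * ‖y‖ ^ (-s) := by positivity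
    simp only [Φ]
    split_ifs with hk
    · have hsub := norm_sub_cell_le hε y
      have hle := le_norm_smul_latticePoint hε hk.1
      set r := ε • latticePoint (cellIndex ε y) with hr
      -- Since the origin is removed, `‖r‖ ≥ ε`, so the cell diameter is controlled by `d * ‖r‖`. As
      -- `s ≥ 0`, the singular value at `r` is then at most `(1 + d) ^ s` times `D₀ * ‖y‖ ^ (-s)`,
      -- an integrable majorant independent of `ε`.
      have hy1 : ‖y‖ ≤ (1 + d) * ‖r‖ := by
        have h2 : ‖y‖ ≤ ‖r‖ + ‖y - r‖ := by
          have := norm_add_le r (y - r)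
          rwa [add_sub_cancel] at this
        have h3 : (d : ℝ) * ε ≤ d * ‖r‖ := mul_le_mul_of_nonneg_left hle (by positivity)
        linarith
      have hr1 : ‖r‖ < 1 := hk.2
      have hr0 : 0 < ‖r‖ := hε.trans_le hle
      have hyb : y ∈ Metric.ball (0 : EuclideanSpace ℝ (Fin d)) (1 + d) := by
        rw [mem_ball_zero_iff]
        have : (1 + d : ℝ) * ‖r‖ < (1 + d) * 1 := mul_lt_mul_of_pos_left hr1 (by positivity)
        linarith
      rw [indicator_of_mem hyb]
      have hc : c ε (cellIndex ε y) = g r * γ₁ ‖r‖ := rfl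
      rw [hc, norm_mul, mul_assoc]
      refine mul_le_mul (hB r (by simpa using hr1.le)) ?_ (norm_nonneg _) hB0
      rw [hD _ hr0 hr1, Real.norm_of_nonneg (by positivity), div_eq_mul_inv, mul_assoc]
      refine mul_le_mul_of_nonneg_left ?_ hD0.le
      rw [Real.rpow_neg (norm_nonneg _), ← div_eq_mul_inv, inv_le_comm₀ (by positivity)
        (by have := norm_pos_iff.2 hy.1; positivity), inv_div,
        div_le_iff₀ (by positivity), mul_comm, ← Real.mul_rpow (by positivity) (by positivity)]
      exact Real.rpow_le_rpow (norm_nonneg _) hy1 hs0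
    · rw [norm_zero]
      exact indicator_nonneg (fun y _ => by positivity) y
  · rw [integrable_indicator_iff measurableSet_ball]
    exact (integrableOn_norm_rpow_neg hd hs (by positivity)).const_mul _
  · filter_upwards [ae_ne_zero_and_norm_ne_one hd] with y hy
    have ht := tendsto_cell y
    rcases lt_or_gt_of_ne hy.2 with hy1 | hy1
    · rw [indicator_of_mem (by simpa using hy1)]
      have hcont : ContinuousAt (fun z : EuclideanSpace ℝ (Fin d) => g z * γ₁ ‖z‖) y := by
        refine hg.continuousAt.mul ?_
        have h0 : 0 < ‖y‖ := norm_pos_iff.2 hy.1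
        have hev : (fun r : ℝ => D₀ / r ^ s) =ᶠ[𝓝 ‖y‖] γ₁ := by
          filter_upwards [Ioo_mem_nhds h0 hy1] with r hr
          exact (hD r hr.1 hr.2).symm
        have hca : ContinuousAt γ₁ ‖y‖ := by
          refine ContinuousAt.congr ?_ hev
          refine continuousAt_const.div (Real.continuousAt_rpow_const _ _ (Or.inl h0.ne')) ?_
          exact (Real.rpow_pos_of_pos h0 s).ne'
        exact ContinuousAt.comp (f := fun z : EuclideanSpace ℝ (Fin d) => ‖z‖) hca
          continuous_norm.continuousAt
      refine Tendsto.congr' ?_ (hcont.tendsto.comp ht)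
      have hn1 : ∀ᶠ ε in 𝓝[>] (0 : ℝ), ‖ε • latticePoint (cellIndex ε y)‖ < 1 :=
        ht.norm.eventually (gt_mem_nhds hy1)
      have hn0 : ∀ᶠ ε in 𝓝[>] (0 : ℝ), ε • latticePoint (cellIndex ε y) ≠ 0 :=
        ht.eventually_ne hy.1
      filter_upwards [hn1, hn0] with ε h1 h0
      simp only [Φ, Function.comp]
      -- The corners tend to `y ≠ 0`, so eventually the removed index `0` is not the one selected.
      rw [if_pos]
      refine ⟨?_, h1⟩
      intro hz
      apply h0
      rw [hz]
      ext i
      simp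
    · rw [indicator_of_notMem (by simpa using hy1.le)]
      have hn1 : ∀ᶠ ε in 𝓝[>] (0 : ℝ), 1 < ‖ε • latticePoint (cellIndex ε y)‖ :=
        ht.norm.eventually (lt_mem_nhds hy1)
      refine tendsto_const_nhds.congr' ?_
      filter_upwards [hn1] with ε h1
      simp only [Φ]
      rw [if_neg]
      intro hk
      exact lt_asymm h1 hk.2

/-! ### Positive exact quadrature on fine lattices -/

/-- The Riemann sum of `g γ₁(|·|)` over the punctured lattice `ε ℤ^d` in the unit ball. -/
noncomputable def latticeSum (d : ℕ) (γ₁ : ℝ → ℝ) (ε : ℝ) (g : EuclideanSpace ℝ (Fin d) → ℝ) : ℝ :=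
  ε ^ d * ∑ᶠ k ∈ latticeStencil d ε, g (ε • latticePoint k) * γ₁ ‖ε • latticePoint k‖

theorem latticeSum_eq_sum {d : ℕ} (γ₁ : ℝ → ℝ) {ε : ℝ} (hε : 0 < ε)
    (g : EuclideanSpace ℝ (Fin d) → ℝ) :
    latticeSum d γ₁ ε g = ε ^ d * ∑ k ∈ (finite_latticeStencil d hε).toFinset,
      g (ε • latticePoint k) * γ₁ ‖ε • latticePoint k‖ := by
  rw [latticeSum, finsum_mem_eq_finite_toFinset_sum _ (finite_latticeStencil d hε)]

theorem latticeSum_linear {d : ℕ} (γ₁ : ℝ → ℝ) {ε : ℝ} (hε : 0 < ε) {ι : Type*} (T : Finset ι)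
    (c : ι → ℝ) (g : ι → EuclideanSpace ℝ (Fin d) → ℝ) :
    latticeSum d γ₁ ε (fun z => ∑ i ∈ T, c i * g i z) = ∑ i ∈ T, c i * latticeSum d γ₁ ε (g i) := by
  simp_rw [latticeSum_eq_sum γ₁ hε, Finset.sum_mul, Finset.mul_sum]
  rw [Finset.sum_comm]
  refine Finset.sum_congr rfl fun i _ => Finset.sum_congr rfl fun k _ => ?_
  ring

theorem IsKernelProfile.integral_linear {d : ℕ} (hd : 0 < d) {s : ℝ} (hs : s < d) {γ₁ : ℝ → ℝ}
    (hγ : IsKernelProfile d s γ₁) {ι : Type*} (T : Finset ι)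
    (c : ι → ℝ) {g : ι → EuclideanSpace ℝ (Fin d) → ℝ} (hg : ∀ i, Continuous (g i)) :
    ∫ z in Metric.ball 0 1, (∑ i ∈ T, c i * g i z) * γ₁ ‖z‖ =
      ∑ i ∈ T, c i * ∫ z in Metric.ball 0 1, g i z * γ₁ ‖z‖ := by
  simp_rw [Finset.sum_mul, mul_assoc]
  rw [integral_finsetSum]
  · simp_rw [integral_const_mul]
  · intro i _
    exact (hγ.integrableOn_mul hd hs (hg i)).const_mul _

theorem continuous_polyVal {d : ℕ} (p : MvPolynomial (Fin d) ℝ) :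
    Continuous (polyVal p : EuclideanSpace ℝ (Fin d) → ℝ) := by
  unfold polyVal
  exact (MvPolynomial.continuous_eval p).comp (by fun_prop)

theorem eq_zero_of_polyVal_eq_zero_on_ball {d : ℕ} {p : MvPolynomial (Fin d) ℝ} {ρ : ℝ}
    (hρ : 0 < ρ) (h : ∀ z ∈ Metric.ball (0 : EuclideanSpace ℝ (Fin d)) ρ, polyVal p z = 0) :
    p = 0 := by
  -- A polynomial vanishing on a product of infinite sets is zero. The cube of side `ρ / (d + 1)`
  -- fits in the ball because `d * (ρ / (d + 1)) < ρ`.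
  refine MvPolynomial.funext_set (fun _ : Fin d => Ioo 0 (ρ / (d + 1)))
    (fun _ => Ioo_infinite (by positivity)) fun x hx => ?_
  rw [map_zero]
  refine h (WithLp.toLp 2 x) ?_
  rw [mem_ball_zero_iff]
  refine (norm_le_of_abs_apply_le (ε := ρ / (d + 1)) (by positivity) fun i => ?_).trans_lt ?_
  · have := hx i (mem_univ i)
    rw [PiLp.toLp_apply, abs_of_pos this.1]
    exact this.2.le
  · rw [mul_div_assoc', div_lt_iff₀ (by positivity)]
    nlinarith

/-- The kernel is strictly positive in the punctured ball, so `p` vanishes almost everywhere in the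
ball, hence everywhere there by continuity. This is the definiteness of the limiting Gram matrix. -/
theorem eq_zero_of_integral_sq_eq_zero {d : ℕ} (hd : 0 < d) {s : ℝ} (hs : s < d) {γ₁ : ℝ → ℝ}
    (hγ : IsKernelProfile d s γ₁) {p : MvPolynomial (Fin d) ℝ}
    (h : ∫ z : EuclideanSpace ℝ (Fin d) in Metric.ball 0 1,
      (polyVal p z * polyVal p z) * γ₁ ‖z‖ = 0) : p = 0 := by
  have hc := continuous_polyVal p
  have hc2 : Continuous fun z : EuclideanSpace ℝ (Fin d) => polyVal p z * polyVal p z := hc.mul hc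
  have hae := ae_ne_zero_and_norm_ne_one hd
  rw [setIntegral_eq_zero_iff_of_nonneg_ae ?_ (hγ.integrableOn_mul hd hs hc2)] at h
  · refine eq_zero_of_polyVal_eq_zero_on_ball one_pos fun z hz => ?_
    refine Measure.eqOn_open_of_ae_eq (μ := volume) (f := polyVal p) (g := fun _ => 0) ?_
      Metric.isOpen_ball hc.continuousOn continuousOn_const hz
    filter_upwards [h, ae_restrict_of_ae hae, ae_restrict_mem measurableSet_ball] with z hz h0 h1
    have hpos := hγ.pos hd (norm_pos_iff.2 h0.1) (by simpa using h1)
    have h2 : (polyVal p z * polyVal p z) * γ₁ ‖z‖ = 0 := hz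
    simpa [hpos.ne'] using h2
  · filter_upwards [ae_restrict_of_ae hae] with z h0
    exact mul_nonneg (mul_self_nonneg _) (hγ.nonneg _ (norm_pos_iff.2 h0.1))

theorem polyVal_sum_smul {d : ℕ} {ι : Type*} (T : Finset ι) (c : ι → ℝ)
    (b : ι → MvPolynomial (Fin d) ℝ) (z : EuclideanSpace ℝ (Fin d)) :
    polyVal (∑ i ∈ T, c i • b i) z = ∑ i ∈ T, c i * polyVal (b i) z := by
  simp [polyVal, MvPolynomial.smul_eval]

open Filter Topology in
/-- On all fine lattices the stencil is unisolvent, and there is a polynomial that is positive on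
the stencil and serves as the density of an exact quadrature rule. -/
theorem exists_lattice_quadrature {d : ℕ} (hd : 0 < d) {s : ℝ} (hs : s < d) {γ₁ : ℝ → ℝ}
    (hγ : IsKernelProfile d s γ₁) :
    ∃ C : ℝ, 0 < C ∧ ∀ ε : ℝ, 0 < ε → ε < C →
      (∀ p : MvPolynomial (Fin d) ℝ, p.totalDegree ≤ 3 →
        (∀ k ∈ latticeStencil d ε, polyVal p (ε • latticePoint k) = 0) → p = 0) ∧
      ∃ q : MvPolynomial (Fin d) ℝ, q.totalDegree ≤ 3 ∧
        (∀ k ∈ latticeStencil d ε, 0 < polyVal q (ε • latticePoint k)) ∧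
        ∀ p : MvPolynomial (Fin d) ℝ, p.totalDegree ≤ 3 →
          latticeSum d γ₁ ε (fun z => polyVal p z * polyVal q z) =
            ∫ z in Metric.ball 0 1, polyVal p z * γ₁ ‖z‖ := by
  let V := MvPolynomial.restrictTotalDegree (Fin d) ℝ 3
  have hV : ∀ p, p ∈ V ↔ p.totalDegree ≤ 3 := fun p =>
    MvPolynomial.mem_restrictTotalDegree (Fin d) 3 p
  let b := Module.finBasis ℝ V
  let n := Module.finrank ℝ V
  let f : Fin n → EuclideanSpace ℝ (Fin d) → ℝ := fun i => polyVal (b i : MvPolynomial (Fin d) ℝ)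
  have hf : ∀ i, Continuous (f i) := fun i => continuous_polyVal _
  have hff : ∀ i j, Continuous fun z => f i z * f j z := fun i j => (hf i).mul (hf j)
  have hP : ∀ (c : Fin n → ℝ) z, polyVal (∑ i, c i • (b i : MvPolynomial (Fin d) ℝ)) z =
      ∑ i, c i * f i z := fun c z => polyVal_sum_smul _ c _ z
  have hrepr : ∀ p, p.totalDegree ≤ 3 → ∃ c : Fin n → ℝ,
      p = ∑ i, c i • (b i : MvPolynomial (Fin d) ℝ) := by
    intro p hp
    refine ⟨b.repr ⟨p, (hV p).2 hp⟩, ?_⟩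
    have := congrArg V.subtype (b.sum_repr ⟨p, (hV p).2 hp⟩)
    simp only [map_sum, map_smul, Submodule.subtype_apply] at this
    exact this.symm
  have hinj : ∀ c : Fin n → ℝ, ∑ i, c i • (b i : MvPolynomial (Fin d) ℝ) = 0 → c = 0 := by
    intro c hc
    funext i
    refine Fintype.linearIndependent_iff.1 b.linearIndependent c ?_ i
    apply Subtype.ext
    simpa using hc
  -- The Gram matrix of cubic polynomials for the inner product weighted by the kernel; `G ε` is its
  -- lattice analogue and converges to it entrywise.
  let G₀ : Matrix (Fin n) (Fin n) ℝ := fun i j => ∫ z in Metric.ball 0 1, (f i z * f j z) * γ₁ ‖z‖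
  let G : ℝ → Matrix (Fin n) (Fin n) ℝ := fun ε i j => latticeSum d γ₁ ε fun z => f i z * f j z
  have hG : Tendsto G (𝓝[>] 0) (𝓝 G₀) := by
    refine tendsto_pi_nhds.2 fun i => tendsto_pi_nhds.2 fun j => ?_
    exact tendsto_lattice_sum hd hs hγ (hff i j)
  -- A null vector `v` would give a polynomial whose square has zero weighted integral.
  have hdet : G₀.det ≠ 0 := by
    rw [Ne, ← Matrix.exists_mulVec_eq_zero_iff]
    rintro ⟨v, hv, hv0⟩
    apply hv
    apply hinj
    apply eq_zero_of_integral_sq_eq_zero hd hs hγ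
    have h1 : ∀ z, polyVal (∑ i, v i • (b i : MvPolynomial (Fin d) ℝ)) z *
        polyVal (∑ i, v i • (b i : MvPolynomial (Fin d) ℝ)) z =
        ∑ i, v i * ∑ j, v j * (f i z * f j z) := by
      intro z
      rw [hP, Finset.sum_mul]
      refine Finset.sum_congr rfl fun i _ => ?_
      rw [Finset.mul_sum, Finset.mul_sum]
      refine Finset.sum_congr rfl fun j _ => ?_
      ring
    simp_rw [h1]
    have hsum : ∀ i, Continuous fun z => ∑ j, v j * (f i z * f j z) := fun i =>
      continuous_finsetSum _ fun j _ => continuous_const.mul (hff i j)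
    rw [hγ.integral_linear hd hs _ _ hsum]
    refine Finset.sum_eq_zero fun i _ => ?_
    rw [hγ.integral_linear hd hs _ _ (hff i)]
    have h2 := congrFun hv0 i
    simp only [Matrix.mulVec, dotProduct, Pi.zero_apply] at h2
    have h3 : ∑ j, v j * G₀ i j = 0 := by simpa only [mul_comm] using h2
    have h4 : ∑ j, v j * ∫ z in Metric.ball 0 1, (f i z * f j z) * γ₁ ‖z‖ = 0 := h3
    rw [h4, mul_zero]
  obtain ⟨c₁, hc₁⟩ := hrepr 1 (by simp)
  have hone : ∀ z, ∑ i, c₁ i * f i z = 1 := by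
    intro z
    rw [← hP, ← hc₁]
    simp [polyVal]
  let r : Fin n → ℝ := fun i => ∫ z in Metric.ball 0 1, f i z * γ₁ ‖z‖
  -- In the continuous limit the exact density is the constant 1, whose coordinates are `c₁`.
  have hr : G₀.mulVec c₁ = r := by
    funext i
    have h1 : ∀ z, f i z = ∑ j, c₁ j * (f i z * f j z) := by
      intro z
      have : ∑ j, c₁ j * (f i z * f j z) = f i z * ∑ j, c₁ j * f j z := by
        rw [Finset.mul_sum]
        exact Finset.sum_congr rfl fun j _ => by ring
      rw [this, hone, mul_one]
    have h2 : r i = ∫ z in Metric.ball 0 1, (∑ j, c₁ j * (f i z * f j z)) * γ₁ ‖z‖ := by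
      simp_rw [← h1]
      rfl
    rw [h2, hγ.integral_linear hd hs _ _ (hff i)]
    simp only [Matrix.mulVec, dotProduct]
    exact Finset.sum_congr rfl fun j _ => mul_comm _ _
  -- The solution of `G ε c = r` by Cramer's rule, a form in which convergence follows from
  -- continuity of determinant and adjugate. It is used only where the determinant is nonzero.
  let c : ℝ → Fin n → ℝ := fun ε => ((G ε).det)⁻¹ • (G ε).adjugate.mulVec r
  have hdetc : Tendsto (fun ε => (G ε).det) (𝓝[>] 0) (𝓝 G₀.det) :=
    ((continuous_id.matrix_det).tendsto G₀).comp hG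
  have hadj : Tendsto (fun ε => (G ε).adjugate.mulVec r) (𝓝[>] 0) (𝓝 (G₀.adjugate.mulVec r)) :=
    (((continuous_id.matrix_adjugate).matrix_mulVec continuous_const).tendsto G₀).comp hG
  have hc : Tendsto c (𝓝[>] 0) (𝓝 c₁) := by
    have h1 := (hdetc.inv₀ hdet).smul hadj
    have h2 : (G₀.det)⁻¹ • G₀.adjugate.mulVec r = c₁ := by
      rw [← hr, Matrix.mulVec_mulVec, Matrix.adjugate_mul, Matrix.smul_mulVec, Matrix.one_mulVec,
        smul_smul, inv_mul_cancel₀ hdet, one_smul]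
    rwa [h2] at h1
  have hbd : ∀ i, ∃ B : ℝ, ∀ z ∈ Metric.closedBall (0 : EuclideanSpace ℝ (Fin d)) 1, ‖f i z‖ ≤ B :=
    fun i => (isCompact_closedBall _ _).exists_bound_of_continuousOn (hf i).continuousOn
  choose B hB using hbd
  have hsmall : Tendsto (fun ε => ∑ i, |c ε i - c₁ i| * B i) (𝓝[>] 0) (𝓝 0) := by
    have h1 : Tendsto (fun ε => ∑ i, |c ε i - c₁ i| * B i) (𝓝[>] 0)
        (𝓝 (∑ i, |c₁ i - c₁ i| * B i)) := by
      refine tendsto_finsetSum _ fun i _ => ?_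
      exact (((tendsto_pi_nhds.1 hc i).sub_const _).abs).mul_const _
    simpa using h1
  -- The sum bounds the distance of the density to 1 on the closed unit ball, so a value below one
  -- forces positivity on the stencil.
  have hev : ∀ᶠ ε in 𝓝[>] (0 : ℝ), (G ε).det ≠ 0 ∧ ∑ i, |c ε i - c₁ i| * B i < 1 :=
    (hdetc.eventually_ne hdet).and (hsmall.eventually (gt_mem_nhds one_pos))
  rw [eventually_nhdsWithin_iff, Metric.eventually_nhds_iff] at hev
  obtain ⟨C, hC, hev⟩ := hev
  refine ⟨C, hC, fun ε hε hεC => ?_⟩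
  obtain ⟨hdε, hsε⟩ := hev (by rwa [Real.dist_eq, sub_zero, abs_of_pos hε]) hε
  have hGmul : ∀ (v : Fin n → ℝ) i, (G ε).mulVec v i =
      latticeSum d γ₁ ε fun z => f i z * polyVal (∑ j, v j • (b j : MvPolynomial (Fin d) ℝ)) z := by
    intro v i
    have h1 : ∀ z, f i z * polyVal (∑ j, v j • (b j : MvPolynomial (Fin d) ℝ)) z =
        ∑ j, v j * (f i z * f j z) := by
      intro z
      rw [hP, Finset.mul_sum]
      exact Finset.sum_congr rfl fun j _ => by ring
    simp_rw [h1]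
    rw [latticeSum_linear γ₁ hε]
    simp only [Matrix.mulVec, dotProduct]
    exact Finset.sum_congr rfl fun j _ => mul_comm _ _
  refine ⟨fun p hp hp0 => ?_, ∑ i, c ε i • (b i : MvPolynomial (Fin d) ℝ), ?_, fun k hk => ?_,
    fun p hp => ?_⟩
  · obtain ⟨v, rfl⟩ := hrepr p hp
    -- A polynomial vanishing on the stencil is orthogonal to every basis element in the lattice
    -- inner product, so its coordinates are annihilated by `G ε`.
    have hv : v = 0 := by
      by_contra hv
      refine hdε (Matrix.exists_mulVec_eq_zero_iff.1 ⟨v, hv, ?_⟩)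
      funext i
      rw [hGmul, latticeSum_eq_sum γ₁ hε, Finset.sum_eq_zero, mul_zero]
      · rfl
      · intro k hk
        rw [hp0 k (by simpa using hk), mul_zero, zero_mul]
    simp [hv]
  · rw [← hV]
    exact Submodule.sum_mem _ fun i _ => Submodule.smul_mem _ _ (b i).2
  · rw [hP]
    have hz : ε • latticePoint k ∈ Metric.closedBall (0 : EuclideanSpace ℝ (Fin d)) 1 := by
      simpa using hk.2.le
    have h1 : |∑ i, c ε i * f i (ε • latticePoint k) - 1| < 1 := by
      have h2 := hone (ε • latticePoint k)
      have h3 : ∑ i, c ε i * f i (ε • latticePoint k) - 1 =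
          ∑ i, (c ε i * f i (ε • latticePoint k) - c₁ i * f i (ε • latticePoint k)) := by
        rw [Finset.sum_sub_distrib, h2]
      rw [h3]
      refine ((Finset.abs_sum_le_sum_abs _ _).trans (Finset.sum_le_sum fun i _ => ?_)).trans_lt hsε
      rw [← sub_mul, abs_mul]
      exact mul_le_mul_of_nonneg_left (hB i _ hz) (abs_nonneg _)
    linarith [(abs_lt.1 h1).1]
  · obtain ⟨v, rfl⟩ := hrepr p hp
    have h1 : (G ε).mulVec (c ε) = r := by
      rw [Matrix.mulVec_smul, Matrix.mulVec_mulVec, Matrix.mul_adjugate, Matrix.smul_mulVec,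
        Matrix.one_mulVec, smul_smul, inv_mul_cancel₀ hdε, one_smul]
    simp_rw [hP v, Finset.sum_mul, mul_assoc]
    rw [latticeSum_linear γ₁ hε]
    have h2 := hγ.integral_linear hd hs Finset.univ v hf
    simp_rw [Finset.sum_mul, mul_assoc] at h2
    rw [h2]
    refine Finset.sum_congr rfl fun i _ => ?_
    rw [← hGmul, h1]

/-! ### Optimal weights and existence of a positivity constant -/

theorem exists_polyVal_scaled {d : ℕ} (p : MvPolynomial (Fin d) ℝ) (t : ℝ) :
    ∃ p' : MvPolynomial (Fin d) ℝ, p'.totalDegree ≤ p.totalDegree ∧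
      ∀ z : EuclideanSpace ℝ (Fin d), polyVal p' z = polyVal p (t • z) := by
  refine ⟨∑ α ∈ p.support, MvPolynomial.monomial α (p.coeff α * ∏ i, t ^ α i), ?_, fun z => ?_⟩
  · refine MvPolynomial.totalDegree_finsetSum_le fun α hα => ?_
    exact (MvPolynomial.totalDegree_monomial_le _ _).trans (MvPolynomial.le_totalDegree hα)
  · rw [polyVal, polyVal, map_sum, MvPolynomial.eval_eq' _ p]
    refine Finset.sum_congr rfl fun α _ => ?_
    rw [MvPolynomial.eval_monomial, Finsupp.prod_fintype _ _ (by simp), mul_assoc,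
      ← Finset.prod_mul_distrib]
    simp [mul_pow]

theorem finite_neighbors {d : ℕ} (hd : 0 < d) {Ω : Set (EuclideanSpace ℝ (Fin d))}
    (hΩb : Bornology.IsBounded Ω) (hΩn : Ω.Nonempty) {δ h : ℝ} (hδ : 0 < δ) (hh : 0 < h)
    (x : EuclideanSpace ℝ (Fin d)) : (neighbors Ω δ h x).Finite :=
  (finite_grid hd hΩb hΩn hδ hh).subset neighbors_subset_grid

theorem rescaledKernel_pos_of_mem_neighbors {d : ℕ} (hd : 0 < d) {s : ℝ} {γ₁ : ℝ → ℝ}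
    (hγ : IsKernelProfile d s γ₁) {Ω : Set (EuclideanSpace ℝ (Fin d))} {δ h : ℝ} (hδ : 0 < δ)
    {x y : EuclideanSpace ℝ (Fin d)} (hy : y ∈ neighbors Ω δ h x) :
    0 < rescaledKernel d γ₁ δ ‖x - y‖ := by
  refine rescaledKernel_pos hd hγ hδ (norm_pos_iff.2 (sub_ne_zero.2 (Ne.symm hy.2))) ?_
  rw [← dist_eq_norm, dist_comm]
  exact hy.1.2

/-- A reproducing weight given by a polynomial of degree at most three is the unique optimal
weight. -/
theorem isOptimalWeight_of_polynomial {d : ℕ} (hd : 0 < d) {s : ℝ} {γ₁ : ℝ → ℝ}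
    (hγ : IsKernelProfile d s γ₁) {Ω : Set (EuclideanSpace ℝ (Fin d))} {δ h : ℝ} (hδ : 0 < δ)
    {x : EuclideanSpace ℝ (Fin d)} (hfin : (neighbors Ω δ h x).Finite)
    {v : EuclideanSpace ℝ (Fin d) → ℝ} (hv : IsReproducing Ω γ₁ δ h x v)
    {q : MvPolynomial (Fin d) ℝ} (hq : q.totalDegree ≤ 3)
    (hqv : ∀ y ∈ neighbors Ω δ h x, v y = polyVal q (y - x)) :
    IsOptimalWeight Ω γ₁ δ h x v ∧
      ∀ w, IsOptimalWeight Ω γ₁ δ h x w → ∀ y ∈ neighbors Ω δ h x, w y = v y := by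
  have hpos : ∀ y ∈ hfin.toFinset, 0 < rescaledKernel d γ₁ δ ‖x - y‖ := fun y hy =>
    rescaledKernel_pos_of_mem_neighbors hd hγ hδ (hfin.mem_toFinset.1 hy)
  -- Pythagoras: the cross term is the sum of `q` times the kernel times `w - v`, and it vanishes
  -- because `w` and `v` both reproduce `q`. Polynomial weights are exactly those to which this
  -- orthogonality applies.
  have hkey : ∀ w, IsReproducing Ω γ₁ δ h x w →
      quadratureObjective Ω γ₁ δ h x w = quadratureObjective Ω γ₁ δ h x v +
        ∑ y ∈ hfin.toFinset, (w y - v y) ^ 2 * rescaledKernel d γ₁ δ ‖x - y‖ / 2 := by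
    intro w hw
    have h1 : ∑ y ∈ hfin.toFinset,
        polyVal q (y - x) * rescaledKernel d γ₁ δ ‖x - y‖ * w y =
        ∑ y ∈ hfin.toFinset, polyVal q (y - x) * rescaledKernel d γ₁ δ ‖x - y‖ * v y := by
      rw [← finsum_mem_eq_finite_toFinset_sum _ hfin, ← finsum_mem_eq_finite_toFinset_sum _ hfin,
        hw q hq, hv q hq]
    rw [quadratureObjective, quadratureObjective, finsum_mem_eq_finite_toFinset_sum _ hfin,
      finsum_mem_eq_finite_toFinset_sum _ hfin]
    have h2 : ∀ y ∈ hfin.toFinset, w y ^ 2 * rescaledKernel d γ₁ δ ‖y - x‖ / 2 =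
        v y ^ 2 * rescaledKernel d γ₁ δ ‖y - x‖ / 2 +
        (w y - v y) ^ 2 * rescaledKernel d γ₁ δ ‖x - y‖ / 2 +
        (polyVal q (y - x) * rescaledKernel d γ₁ δ ‖x - y‖ * w y -
          polyVal q (y - x) * rescaledKernel d γ₁ δ ‖x - y‖ * v y) := by
      intro y hy
      rw [← hqv y (hfin.mem_toFinset.1 hy), norm_sub_rev y x]
      ring
    rw [Finset.sum_congr rfl h2, Finset.sum_add_distrib, Finset.sum_add_distrib,
      Finset.sum_sub_distrib, h1, sub_self, add_zero]
  refine ⟨⟨hv, fun w hw => ?_⟩, fun w hw y hy => ?_⟩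
  · rw [hkey w hw]
    refine le_add_of_nonneg_right (Finset.sum_nonneg fun y hy => ?_)
    have := (hpos y hy).le
    positivity
  · have h1 := hw.2 v hv
    rw [hkey w hw.1] at h1
    have h2 : ∀ y ∈ hfin.toFinset,
        0 ≤ (w y - v y) ^ 2 * rescaledKernel d γ₁ δ ‖x - y‖ / 2 := by
      intro y hy
      have := (hpos y hy).le
      positivity
    have h3 := (Finset.sum_eq_zero_iff_of_nonneg h2).1
      (le_antisymm (by linarith) (Finset.sum_nonneg h2)) y (hfin.mem_toFinset.2 hy)
    have h4 := (hpos y (hfin.mem_toFinset.2 hy)).ne'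
    have h5 : (w y - v y) ^ 2 = 0 := by
      rw [div_eq_zero_iff, mul_eq_zero] at h3
      rcases h3 with (h3 | h3) | h3
      · exact h3
      · exact absurd h3 h4
      · norm_num at h3
    exact sub_eq_zero.1 (pow_eq_zero_iff two_ne_zero |>.1 h5)

theorem finsum_neighbors_eq {d : ℕ} (hd : 0 < d) {Ω : Set (EuclideanSpace ℝ (Fin d))}
    (hΩb : Bornology.IsBounded Ω) (hΩn : Ω.Nonempty) {δ h : ℝ} (hδ : 0 < δ) (hh : 0 < h)
    {x : EuclideanSpace ℝ (Fin d)} (hx : x ∈ grid Ω δ h ∩ Ω)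
    (F : EuclideanSpace ℝ (Fin d) → ℝ) :
    ∑ᶠ y ∈ neighbors Ω δ h x, F y = ∑ᶠ k ∈ latticeStencil d (h / δ),
      F (x + δ • ((h / δ) • latticePoint k)) := by
  rw [neighbors_eq_image hd hΩb hΩn hδ hh hx, finsum_mem_image]
  intro k _ l _ hkl
  have h1 : δ • ((h / δ) • latticePoint k) = δ • ((h / δ) • latticePoint l) := add_left_cancel hkl
  exact latticePoint_injective
    (smul_right_injective _ (div_pos hh hδ).ne' (smul_right_injective _ hδ.ne' h1))

/-- The lattice density, transported to scale `δ`, gives a polynomial reproducing weight. Such a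
weight is the unique optimum, so its positivity is that of every optimal weight. -/
theorem exists_isPositivityConstant {d : ℕ} (hd : 0 < d) {s : ℝ} (hs : s < d) {γ₁ : ℝ → ℝ}
    (hγ : IsKernelProfile d s γ₁) {Ω : Set (EuclideanSpace ℝ (Fin d))}
    (hΩb : Bornology.IsBounded Ω) (hΩn : Ω.Nonempty) :
    ∃ C : ℝ, IsPositivityConstant Ω γ₁ C := by
  obtain ⟨C, hC, hCq⟩ := exists_lattice_quadrature hd hs hγ
  refine ⟨C, hC, fun δ h hδ hh hhC x hx => ?_⟩
  have hε : 0 < h / δ := div_pos hh hδ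
  obtain ⟨huni, q, hq, hqpos, hqrep⟩ := hCq (h / δ) hε ((div_lt_iff₀ hδ).2 hhC)
  have hfin := finite_neighbors hd hΩb hΩn hδ hh x
  -- The weight is `h ^ d * q((y - x) / δ)`: a cell volume times the density. With `h ^ d = (h / δ)
  -- ^ d * δ ^ d` it matches the factor `1 / δ ^ 2` of the rescaled integral.
  obtain ⟨q', hq', hqq'⟩ := exists_polyVal_scaled (MvPolynomial.C (h ^ d) * q) δ⁻¹
  have hq'3 : q'.totalDegree ≤ 3 := by
    refine hq'.trans ((MvPolynomial.totalDegree_mul _ _).trans ?_)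
    rwa [MvPolynomial.totalDegree_C, zero_add]
  have hq'val : ∀ z, polyVal q' (δ • z) = h ^ d * polyVal q z := by
    intro z
    rw [hqq', smul_smul, inv_mul_cancel₀ hδ.ne', one_smul]
    simp [polyVal]
  have hrep : IsReproducing Ω γ₁ δ h x fun y => polyVal q' (y - x) := by
    intro p hp
    obtain ⟨p', hp', hpp'⟩ := exists_polyVal_scaled p δ
    rw [setIntegral_ball_rescaledKernel γ₁ hδ x, finsum_neighbors_eq hd hΩb hΩn hδ hh hx]
    simp_rw [← hpp']
    rw [← hqrep p' (hp'.trans hp), latticeSum_eq_sum γ₁ hε,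
      finsum_mem_eq_finite_toFinset_sum _ (finite_latticeStencil d hε), Finset.mul_sum,
      Finset.mul_sum]
    refine Finset.sum_congr rfl fun k _ => ?_
    have hn : ‖x - (x + δ • (h / δ) • latticePoint k)‖ = δ * ‖(h / δ) • latticePoint k‖ := by
      rw [sub_add_cancel_left, norm_neg, norm_smul δ, Real.norm_of_nonneg hδ.le]
    rw [add_sub_cancel_left, hq'val, hn, rescaledKernel, mul_div_cancel_left₀ _ hδ.ne', hpp',
      div_pow, pow_add]
    field_simp
  obtain ⟨hopt, huniq⟩ := isOptimalWeight_of_polynomial hd hγ hδ hfin hrep hq'3 fun _ _ => rfl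
  refine ⟨fun p hp hp0 => ?_, ⟨_, hopt⟩, fun w hw y hy => ?_⟩
  · obtain ⟨p', hp', hpp'⟩ := exists_polyVal_scaled p δ
    have hz : p' = 0 := by
      refine huni p' (hp'.trans hp) fun k hk => ?_
      have h1 := hp0 (x + δ • ((h / δ) • latticePoint k)) (by
        rw [neighbors_eq_image hd hΩb hΩn hδ hh hx]
        exact ⟨k, hk, rfl⟩)
      rwa [add_sub_cancel_left, ← hpp'] at h1
    refine eq_zero_of_polyVal_eq_zero_on_ball one_pos fun z _ => ?_
    have h1 := hpp' (δ⁻¹ • z)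
    rw [smul_smul, mul_inv_cancel₀ hδ.ne', one_smul, hz] at h1
    rw [← h1]
    simp [polyVal]
  · rw [huniq w hw y hy]
    rw [neighbors_eq_image hd hΩb hΩn hδ hh hx] at hy
    obtain ⟨k, hk, rfl⟩ := hy
    simp only [add_sub_cancel_left]
    rw [hq'val]
    exact mul_pos (by positivity) (hqpos k hk)

/-! ### Consistency of the nonlocal and discrete operators -/

/-- The limit `a Δu + 2 ∇₂A(x, x) · ∇u` of the nonlocal operators, written as the Laplacian at `x`
of `y ↦ A(x, y) (u(y) - u(x))`. -/
noncomputable def limitOperator {d : ℕ}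
    (A : EuclideanSpace ℝ (Fin d) → EuclideanSpace ℝ (Fin d) → ℝ)
    (u : EuclideanSpace ℝ (Fin d) → ℝ) (x : EuclideanSpace ℝ (Fin d)) : ℝ :=
  ∑ i, iteratedFDeriv ℝ 2 (fun y => A x y * (u y - u x)) x (fun _ => EuclideanSpace.single i 1)

/-- One Taylor polynomial serves both the integral and the quadrature sum. The constant is `16 * K *
(2 * K')`, from the product bound and the subtraction of `u x`. -/
theorem exists_limitOperator_polynomial {d : ℕ} (hd : 0 < d) {s : ℝ} (hs : s < d) {γ₁ : ℝ → ℝ}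
    (hγ : IsKernelProfile d s γ₁) {D : Set (EuclideanSpace ℝ (Fin d))} (hD : IsOpen D)
    {A : EuclideanSpace ℝ (Fin d) → EuclideanSpace ℝ (Fin d) → ℝ}
    {u : EuclideanSpace ℝ (Fin d) → ℝ} {K K' δ : ℝ} (hδ : 0 < δ)
    {x : EuclideanSpace ℝ (Fin d)} (hxD : Metric.ball x δ ⊆ D)
    (hA : HasC4Bound D K (A x)) (hu : HasC4Bound D K' u) :
    ∃ p : MvPolynomial (Fin d) ℝ, p.totalDegree ≤ 3 ∧
      (∀ y ∈ Metric.ball x δ,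
        |A x y * (u y - u x) - polyVal p (y - x)| ≤ 32 * K * K' * ‖y - x‖ ^ 4) ∧
      2 * ∫ y in Metric.ball x δ, polyVal p (y - x) * rescaledKernel d γ₁ δ ‖x - y‖ =
        limitOperator A u x := by
  have hx : x ∈ D := hxD (Metric.mem_ball_self hδ)
  have hF := hA.mul hD (hu.sub_const hD hx)
  have hc : 16 * K * (2 * K') = 32 * K * K' := by ring
  rw [hc] at hF
  exact exists_taylor_polynomial hd hs hγ hδ (fun y hy => hF.contDiffAt hD (hxD hy))
    (fun y hy => hF.norm_iteratedFDeriv_le hD le_rfl (hxD hy)) (by simp)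

theorem IsKernelProfile.rescaled_moment {d : ℕ} {s : ℝ} {γ₁ : ℝ → ℝ} (hγ : IsKernelProfile d s γ₁)
    {δ : ℝ} (hδ : 0 < δ) (x : EuclideanSpace ℝ (Fin d)) :
    ∫ y in Metric.ball x δ, ‖y - x‖ ^ 2 * rescaledKernel d γ₁ δ ‖x - y‖ = d := by
  rw [setIntegral_ball_rescaledKernel γ₁ hδ x (fun z => ‖z‖ ^ 2), ← hγ.moment,
    ← integral_const_mul]
  congr 1
  ext z
  rw [norm_smul, Real.norm_of_nonneg hδ.le]
  field_simp

/-- Since `‖z‖ ^ 2` is reproduced exactly, the discrete second moment of the kernel is again `d`. -/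
theorem exists_polyVal_eq_norm_sq (d : ℕ) : ∃ p : MvPolynomial (Fin d) ℝ, p.totalDegree ≤ 3 ∧
    ∀ z : EuclideanSpace ℝ (Fin d), polyVal p z = ‖z‖ ^ 2 := by
  refine ⟨∑ i, MvPolynomial.X i ^ 2, ?_, fun z => ?_⟩
  · refine MvPolynomial.totalDegree_finsetSum_le fun i _ => ?_
    rw [MvPolynomial.totalDegree_X_pow]
    norm_num
  · rw [EuclideanSpace.norm_sq_eq]
    simp [polyVal]

theorem integrableOn_mul_rescaledKernel {d : ℕ} (hd : 0 < d) {s : ℝ} (hs : s < d) {γ₁ : ℝ → ℝ}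
    (hγ : IsKernelProfile d s γ₁) {δ : ℝ} (hδ : 0 < δ) {x : EuclideanSpace ℝ (Fin d)}
    {g : EuclideanSpace ℝ (Fin d) → ℝ} (hg : ContinuousOn g (Metric.ball x δ)) {B : ℝ}
    (hB : ∀ y ∈ Metric.ball x δ, |g y| ≤ B) :
    IntegrableOn (fun y => g y * rescaledKernel d γ₁ δ ‖x - y‖) (Metric.ball x δ) := by
  refine Integrable.bdd_mul (c := B) (integrableOn_ball_rescaledKernel hd hs hγ hδ x)
    (hg.aestronglyMeasurable measurableSet_ball) ?_
  rw [ae_restrict_iff' measurableSet_ball]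
  exact Filter.Eventually.of_forall hB

theorem rescaledKernel_eq_zero_of_notMem_ball {d : ℕ} {s : ℝ} {γ₁ : ℝ → ℝ}
    (hγ : IsKernelProfile d s γ₁) {δ : ℝ} (hδ : 0 < δ) {x y : EuclideanSpace ℝ (Fin d)}
    (hy : y ∉ Metric.ball x δ) : rescaledKernel d γ₁ δ ‖x - y‖ = 0 := by
  refine rescaledKernel_of_le hγ hδ ?_
  rw [← dist_eq_norm, dist_comm]
  simpa using hy

theorem integrable_nonlocal_of_hasC4Bound {d : ℕ} (hd : 0 < d) {s : ℝ} (hs : s < d) {γ₁ : ℝ → ℝ}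
    (hγ : IsKernelProfile d s γ₁) {D : Set (EuclideanSpace ℝ (Fin d))} (hD : IsOpen D)
    {A : EuclideanSpace ℝ (Fin d) → EuclideanSpace ℝ (Fin d) → ℝ}
    {u : EuclideanSpace ℝ (Fin d) → ℝ} {K K' δ : ℝ} (hδ : 0 < δ)
    {x : EuclideanSpace ℝ (Fin d)} (hxD : Metric.ball x δ ⊆ D)
    (hA : HasC4Bound D K (A x)) (hu : HasC4Bound D K' u) :
    Integrable (fun y => A x y * rescaledKernel d γ₁ δ ‖x - y‖ * (u y - u x)) := by
  have hF := hA.mul hD (hu.sub_const hD (hxD (Metric.mem_ball_self hδ)))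
  have h := integrableOn_mul_rescaledKernel hd hs hγ hδ (x := x)
    (hF.1.continuousOn.mono hxD) (fun y hy => hF.abs_le (hxD hy))
  rw [← integrableOn_iff_integrable_of_support_subset (s := Metric.ball x δ)]
  · refine h.congr_fun (fun y _ => ?_) measurableSet_ball
    simp only
    ring
  · intro y hy
    by_contra hy'
    apply hy
    simp only
    rw [rescaledKernel_eq_zero_of_notMem_ball hγ hδ hy', mul_zero, zero_mul]

/-- Only the Taylor remainder contributes. One factor `‖y - x‖ ^ 2` is bounded by `δ ^ 2`, the other
is integrated to `d`, and the operator carries a factor 2. -/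
theorem abs_nonlocalOperator_sub_limitOperator_le {d : ℕ} (hd : 0 < d) {s : ℝ} (hs : s < d)
    {γ₁ : ℝ → ℝ} (hγ : IsKernelProfile d s γ₁) {D : Set (EuclideanSpace ℝ (Fin d))}
    (hD : IsOpen D) {A : EuclideanSpace ℝ (Fin d) → EuclideanSpace ℝ (Fin d) → ℝ}
    {u : EuclideanSpace ℝ (Fin d) → ℝ} {K K' δ : ℝ} (hδ : 0 < δ)
    {x : EuclideanSpace ℝ (Fin d)} (hxD : Metric.ball x δ ⊆ D)
    (hA : HasC4Bound D K (A x)) (hu : HasC4Bound D K' u) :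
    |nonlocalOperator A γ₁ δ u x - limitOperator A u x| ≤ 64 * d * K * K' * δ ^ 2 := by
  have hx : x ∈ D := hxD (Metric.mem_ball_self hδ)
  have hKK : 0 ≤ 32 * K * K' := by
    have := hA.nonneg_of_mem hx
    have := hu.nonneg_of_mem hx
    positivity
  obtain ⟨p, -, hp, hpint⟩ := exists_limitOperator_polynomial hd hs hγ hD hδ hxD hA hu
  have hF := hA.mul hD (hu.sub_const hD hx)
  have hFint := integrableOn_mul_rescaledKernel hd hs hγ hδ (x := x)
    (hF.1.continuousOn.mono hxD) (fun y hy => hF.abs_le (hxD hy))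
  have hcont : ∀ {g : EuclideanSpace ℝ (Fin d) → ℝ}, Continuous g →
      IntegrableOn (fun y => g y * rescaledKernel d γ₁ δ ‖x - y‖) (Metric.ball x δ) := by
    intro g hg
    obtain ⟨B, hB⟩ := (isCompact_closedBall x δ).exists_bound_of_continuousOn hg.continuousOn
    exact integrableOn_mul_rescaledKernel hd hs hγ hδ hg.continuousOn
      fun y hy => hB y (Metric.ball_subset_closedBall hy)
  have hpI := hcont (g := fun y => polyVal p (y - x)) ((continuous_polyVal p).comp (by fun_prop))
  have hqI := hcont (g := fun y => ‖y - x‖ ^ 2) (by fun_prop)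
  have hL : nonlocalOperator A γ₁ δ u x = 2 * ∫ y in Metric.ball x δ,
      A x y * (u y - u x) * rescaledKernel d γ₁ δ ‖x - y‖ := by
    rw [nonlocalOperator, ← setIntegral_eq_integral_of_forall_compl_eq_zero
      (s := Metric.ball x δ)]
    · congr 2
      ext y
      ring
    · intro y hy
      rw [rescaledKernel_eq_zero_of_notMem_ball hγ hδ hy, mul_zero, zero_mul]
  rw [hL, ← hpint, ← mul_sub, ← integral_sub hFint hpI, abs_mul, abs_two]
  have hbound : ‖∫ y in Metric.ball x δ, (A x y * (u y - u x) * rescaledKernel d γ₁ δ ‖x - y‖ -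
      polyVal p (y - x) * rescaledKernel d γ₁ δ ‖x - y‖)‖ ≤
      ∫ y in Metric.ball x δ, (32 * K * K' * δ ^ 2) *
        (‖y - x‖ ^ 2 * rescaledKernel d γ₁ δ ‖x - y‖) := by
    refine norm_integral_le_of_norm_le (hqI.const_mul _) ?_
    rw [ae_restrict_iff' measurableSet_ball]
    have : Nonempty (Fin d) := ⟨⟨0, hd⟩⟩
    have hne : ∀ᵐ y : EuclideanSpace ℝ (Fin d), y ≠ x := by simp [ae_iff]
    filter_upwards [hne] with y hyx hy
    have hk : 0 ≤ rescaledKernel d γ₁ δ ‖x - y‖ :=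
      rescaledKernel_nonneg hγ hδ (norm_pos_iff.2 (sub_ne_zero.2 hyx.symm))
    rw [← sub_mul, norm_mul, Real.norm_eq_abs, Real.norm_of_nonneg hk, ← mul_assoc]
    refine mul_le_mul_of_nonneg_right ((hp y hy).trans ?_) hk
    have hyδ : ‖y - x‖ ≤ δ := by rw [← dist_eq_norm]; exact (Metric.mem_ball.1 hy).le
    have h2 : ‖y - x‖ ^ 2 ≤ δ ^ 2 := pow_le_pow_left₀ (norm_nonneg _) hyδ 2
    calc 32 * K * K' * ‖y - x‖ ^ 4 = 32 * K * K' * (‖y - x‖ ^ 2 * ‖y - x‖ ^ 2) := by ring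
      _ ≤ 32 * K * K' * (δ ^ 2 * ‖y - x‖ ^ 2) :=
        mul_le_mul_of_nonneg_left (mul_le_mul_of_nonneg_right h2 (by positivity)) hKK
      _ = _ := by ring
  rw [integral_const_mul, hγ.rescaled_moment hδ x] at hbound
  rw [Real.norm_eq_abs] at hbound
  linarith

/-- Exactness on the Taylor polynomial reduces the difference to the remainder. Positivity of the
weights lets absolute values pass inside the sum without loss, after which exactness on `‖z‖ ^ 2`
bounds it independently of `h / δ`. -/
theorem abs_discreteOperator_sub_limitOperator_le {d : ℕ} (hd : 0 < d) {s : ℝ} (hs : s < d)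
    {γ₁ : ℝ → ℝ} (hγ : IsKernelProfile d s γ₁) {Ω D : Set (EuclideanSpace ℝ (Fin d))}
    (hD : IsOpen D) {A : EuclideanSpace ℝ (Fin d) → EuclideanSpace ℝ (Fin d) → ℝ}
    {u : EuclideanSpace ℝ (Fin d) → ℝ} {K K' δ h : ℝ} (hδ : 0 < δ)
    {x : EuclideanSpace ℝ (Fin d)} (hxD : Metric.ball x δ ⊆ D)
    (hA : HasC4Bound D K (A x)) (hu : HasC4Bound D K' u) (hfin : (neighbors Ω δ h x).Finite)
    {wt : EuclideanSpace ℝ (Fin d) → EuclideanSpace ℝ (Fin d) → ℝ}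
    (hrep : IsReproducing Ω γ₁ δ h x fun y => wt y x)
    (hpos : ∀ y ∈ neighbors Ω δ h x, 0 < wt y x) :
    |discreteOperator Ω A γ₁ δ h wt u x - limitOperator A u x| ≤ 64 * d * K * K' * δ ^ 2 := by
  have hx : x ∈ D := hxD (Metric.mem_ball_self hδ)
  have hKK : 0 ≤ 32 * K * K' := by
    have := hA.nonneg_of_mem hx
    have := hu.nonneg_of_mem hx
    positivity
  obtain ⟨p, hpdeg, hp, hpint⟩ := exists_limitOperator_polynomial hd hs hγ hD hδ hxD hA hu
  obtain ⟨q, hqdeg, hq⟩ := exists_polyVal_eq_norm_sq d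
  have hprep := hrep p hpdeg
  have hqrep := hrep q hqdeg
  simp_rw [hq] at hqrep
  rw [hγ.rescaled_moment hδ x, finsum_mem_eq_finite_toFinset_sum _ hfin] at hqrep
  rw [← hpint, ← hprep, discreteOperator, finsum_mem_eq_finite_toFinset_sum _ hfin,
    finsum_mem_eq_finite_toFinset_sum _ hfin, ← mul_sub, ← Finset.sum_sub_distrib, abs_mul, abs_two]
  have hbound : |∑ y ∈ hfin.toFinset,
      (A x y * rescaledKernel d γ₁ δ ‖x - y‖ * (u y - u x) * wt y x -
        polyVal p (y - x) * rescaledKernel d γ₁ δ ‖x - y‖ * wt y x)| ≤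
      32 * K * K' * δ ^ 2 * ∑ y ∈ hfin.toFinset,
        ‖y - x‖ ^ 2 * rescaledKernel d γ₁ δ ‖x - y‖ * wt y x := by
    rw [Finset.mul_sum]
    refine (Finset.abs_sum_le_sum_abs _ _).trans (Finset.sum_le_sum fun y hy => ?_)
    rw [hfin.mem_toFinset] at hy
    have hk : 0 ≤ rescaledKernel d γ₁ δ ‖x - y‖ * wt y x :=
      mul_nonneg (rescaledKernel_pos_of_mem_neighbors hd hγ hδ hy).le (hpos y hy).le
    have hyδ : ‖y - x‖ ≤ δ := by rw [← dist_eq_norm]; exact (Metric.mem_ball.1 hy.1.2).le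
    have h2 : ‖y - x‖ ^ 2 ≤ δ ^ 2 := pow_le_pow_left₀ (norm_nonneg _) hyδ 2
    calc _ = |A x y * (u y - u x) - polyVal p (y - x)| *
          (rescaledKernel d γ₁ δ ‖x - y‖ * wt y x) := by
          conv_rhs => rw [← abs_of_nonneg hk, ← abs_mul]
          congr 1
          ring
      _ ≤ 32 * K * K' * (δ ^ 2 * ‖y - x‖ ^ 2) * (rescaledKernel d γ₁ δ ‖x - y‖ * wt y x) := by
          refine mul_le_mul_of_nonneg_right ((hp y hy.1.2).trans ?_) hk
          calc 32 * K * K' * ‖y - x‖ ^ 4 = 32 * K * K' * (‖y - x‖ ^ 2 * ‖y - x‖ ^ 2) := by ring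
            _ ≤ _ := mul_le_mul_of_nonneg_left
              (mul_le_mul_of_nonneg_right h2 (by positivity)) hKK
      _ = _ := by ring
  rw [hqrep] at hbound
  linarith

/-! ### The limit operator is the local operator -/

theorem hasDerivAt_comp_add_smul {E : Type*} [NormedAddCommGroup E] [NormedSpace ℝ E] {f : E → ℝ}
    {x v : E} {t : ℝ} (hf : DifferentiableAt ℝ f (x + t • v)) :
    HasDerivAt (fun r : ℝ => f (x + r • v)) (fderiv ℝ f (x + t • v) v) t := by
  have h1 : HasDerivAt (fun r : ℝ => x + r • v) v t := by
    simpa using ((hasDerivAt_id t).smul_const v).const_add x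
  exact hf.hasFDerivAt.comp_hasDerivAt t h1

/-- In the product rule the term with the second derivative of `a` carries the factor `u x - u x =
0`. -/
theorem iteratedFDeriv_two_mul_sub {E : Type*} [NormedAddCommGroup E] [NormedSpace ℝ E]
    {a u : E → ℝ} {x : E} (ha : ContDiffAt ℝ 2 a x) (hu : ContDiffAt ℝ 2 u x) (e : E) :
    iteratedFDeriv ℝ 2 (fun y => a y * (u y - u x)) x (fun _ => e) =
      a x * fderiv ℝ (fun y => fderiv ℝ u y e) x e + 2 * fderiv ℝ a x e * fderiv ℝ u x e := by
  have hev : fderiv ℝ (fun y => a y * (u y - u x)) =ᶠ[nhds x]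
      fun y => a y • fderiv ℝ u y + (u y - u x) • fderiv ℝ a y := by
    filter_upwards [ha.eventually (by simp), hu.eventually (by simp)] with y hay huy
    have h1 := (hay.differentiableAt (by norm_num)).hasFDerivAt
    have h2 := (huy.differentiableAt (by norm_num)).hasFDerivAt
    exact (h1.mul (h2.sub_const (u x))).fderiv
  have ha1 := (ha.differentiableAt (by norm_num)).hasFDerivAt
  have hu1 := (hu.differentiableAt (by norm_num)).hasFDerivAt
  have hda : DifferentiableAt ℝ (fderiv ℝ a) x :=
    (ha.fderiv_right (m := 1) (by norm_num)).differentiableAt (by norm_num)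
  have hdu : DifferentiableAt ℝ (fderiv ℝ u) x :=
    (hu.fderiv_right (m := 1) (by norm_num)).differentiableAt (by norm_num)
  have hdue : fderiv ℝ (fun y => fderiv ℝ u y e) x e = fderiv ℝ (fderiv ℝ u) x e e := by
    rw [fderiv_clm_apply hdu (differentiableAt_const e)]
    simp
  have h := ((ha1.smul hdu.hasFDerivAt).add ((hu1.sub_const (u x)).smul hda.hasFDerivAt)).fderiv
  rw [iteratedFDeriv_two_apply, hev.fderiv_eq, hdue]
  erw [h]
  simp
  ring

theorem limitOperator_eq {d : ℕ} {D : Set (EuclideanSpace ℝ (Fin d))} (hD : IsOpen D)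
    {A : EuclideanSpace ℝ (Fin d) → EuclideanSpace ℝ (Fin d) → ℝ}
    {u : EuclideanSpace ℝ (Fin d) → ℝ} {K K' : ℝ} {x : EuclideanSpace ℝ (Fin d)} (hx : x ∈ D)
    (hA : HasC4Bound D K (A x)) (hu : HasC4Bound D K' u) :
    limitOperator A u x = ∑ i : Fin d,
      (A x x * fderiv ℝ (fun y => fderiv ℝ u y (EuclideanSpace.single i 1)) x
        (EuclideanSpace.single i 1) +
      2 * fderiv ℝ (A x) x (EuclideanSpace.single i 1) *
        fderiv ℝ u x (EuclideanSpace.single i 1)) :=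
  Finset.sum_congr rfl fun i _ =>
    iteratedFDeriv_two_mul_sub ((hA.contDiffAt hD hx).of_le (by norm_num))
      ((hu.contDiffAt hD hx).of_le (by norm_num)) _

/-- A symmetric function with bounded second derivatives in one of its variables has mixed second
differences of smaller order on the diagonal. -/
theorem mixed_difference_le {B B1 B2 : ℝ → ℝ → ℝ} {σ₀ L : ℝ} (hσ₀ : 0 < σ₀)
    (hsymm : ∀ t ∈ Icc 0 σ₀, ∀ r ∈ Icc 0 σ₀, B t r = B r t)
    (hB1 : ∀ t ∈ Icc 0 σ₀, ∀ r ∈ Icc 0 σ₀, HasDerivAt (B t) (B1 t r) r)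
    (hB2 : ∀ t ∈ Icc 0 σ₀, ∀ r ∈ Icc 0 σ₀, HasDerivAt (B1 t) (B2 t r) r)
    (hL1 : ∀ t ∈ Icc 0 σ₀, ∀ r ∈ Icc 0 σ₀, |B1 t r| ≤ L)
    (hL2 : ∀ t ∈ Icc 0 σ₀, ∀ r ∈ Icc 0 σ₀, |B2 t r| ≤ L) {σ t : ℝ} (hσ : 0 < σ) (hσσ : σ ≤ σ₀)
    (ht : 0 ≤ t) (htσ : t ≤ σ) :
    |B t t - B t 0 - B 0 t + B 0 0| ≤ (2 * L * t / σ + 2 * L * σ) * t := by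
  have hsub : ∀ r ∈ Icc 0 σ, r ∈ Icc 0 σ₀ := fun r hr => ⟨hr.1, hr.2.trans hσσ⟩
  have h0m : (0 : ℝ) ∈ Icc 0 σ₀ := ⟨le_rfl, hσ₀.le⟩
  have htm : t ∈ Icc 0 σ₀ := ⟨ht, htσ.trans hσσ⟩
  have hφ : ∀ r ∈ Icc 0 σ, HasDerivAt (fun r => B t r - B 0 r) (B1 t r - B1 0 r) r := fun r hr =>
    (hB1 t htm r (hsub r hr)).sub (hB1 0 h0m r (hsub r hr))
  have hφ1 : ∀ r ∈ Icc 0 σ, HasDerivAt (fun r => B1 t r - B1 0 r) (B2 t r - B2 0 r) r :=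
    fun r hr => (hB2 t htm r (hsub r hr)).sub (hB2 0 h0m r (hsub r hr))
  -- Symmetry moves the increment in the first variable to the second, where a derivative bound is
  -- available.
  have hval : ∀ r ∈ Icc 0 σ, |B t r - B 0 r| ≤ L * t := by
    intro r hr
    have h1 := Convex.norm_image_sub_le_of_norm_hasDerivWithin_le (f := B r) (f' := B1 r)
      (s := Icc 0 σ₀) (C := L) (x := 0) (y := t)
      (fun q hq => (hB1 r (hsub r hr) q hq).hasDerivWithinAt)
      (fun q hq => hL1 r (hsub r hr) q hq) (convex_Icc 0 σ₀) h0m htm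
    rw [hsymm t htm r (hsub r hr), hsymm 0 h0m r (hsub r hr)]
    simpa [abs_of_nonneg ht] using h1
  -- Interpolation between orders zero and two: `r ↦ B t r - B 0 r` is of size `L * t`, so its
  -- derivative is at most `2 * L * t / σ` somewhere in `(0, σ)`, and the bound on second
  -- derivatives propagates this to all of `[0, σ]` at the cost of `2 * L * σ`.
  obtain ⟨ξ, hξ, hξ'⟩ := exists_hasDerivAt_eq_slope (fun r => B t r - B 0 r)
    (fun r => B1 t r - B1 0 r) hσ (fun r hr => (hφ r hr).continuousAt.continuousWithinAt)
    (fun r hr => hφ r ⟨hr.1.le, hr.2.le⟩)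
  have hξI : ξ ∈ Icc 0 σ := ⟨hξ.1.le, hξ.2.le⟩
  have hξb : |B1 t ξ - B1 0 ξ| ≤ 2 * L * t / σ := by
    have h1 : B1 t ξ - B1 0 ξ = (B t σ - B 0 σ - (B t 0 - B 0 0)) / (σ - 0) := hξ'
    rw [h1, sub_zero, abs_div, abs_of_pos hσ]
    refine div_le_div_of_nonneg_right ?_ hσ.le
    have h2 := hval σ ⟨hσ.le, le_rfl⟩
    have h3 := hval 0 ⟨le_rfl, hσ.le⟩
    have h4 := abs_sub (B t σ - B 0 σ) (B t 0 - B 0 0)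
    linarith
  have hder : ∀ r ∈ Icc 0 σ, |B1 t r - B1 0 r| ≤ 2 * L * t / σ + 2 * L * σ := by
    intro r hr
    have h1 := Convex.norm_image_sub_le_of_norm_hasDerivWithin_le
      (f := fun r => B1 t r - B1 0 r) (f' := fun r => B2 t r - B2 0 r)
      (s := Icc 0 σ) (C := 2 * L) (x := ξ) (y := r)
      (fun q hq => (hφ1 q hq).hasDerivWithinAt)
      (fun q hq => by
        have h2 := hL2 t htm q (hsub q hq)
        have h3 := hL2 0 h0m q (hsub q hq)
        have h4 := abs_sub (B2 t q) (B2 0 q)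
        rw [Real.norm_eq_abs]
        linarith) (convex_Icc 0 σ) hξI hr
    rw [Real.norm_eq_abs, Real.norm_eq_abs] at h1
    have hL : 0 ≤ L := (abs_nonneg _).trans (hL1 t htm t htm)
    have h5 : |r - ξ| ≤ σ := by
      rw [abs_le]
      constructor <;> linarith [hr.1, hr.2, hξ.1, hξ.2]
    have h6 : 2 * L * |r - ξ| ≤ 2 * L * σ := mul_le_mul_of_nonneg_left h5 (by positivity)
    have h7 := abs_sub_abs_le_abs_sub (B1 t r - B1 0 r) (B1 t ξ - B1 0 ξ)
    linarith
  have hfin := Convex.norm_image_sub_le_of_norm_hasDerivWithin_le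
      (f := fun r => B t r - B 0 r) (f' := fun r => B1 t r - B1 0 r)
      (s := Icc 0 σ) (C := 2 * L * t / σ + 2 * L * σ) (x := 0) (y := t)
      (fun q hq => (hφ q hq).hasDerivWithinAt) hder (convex_Icc 0 σ) ⟨le_rfl, hσ.le⟩ ⟨ht, htσ⟩
  rw [Real.norm_eq_abs, Real.norm_eq_abs, sub_zero, abs_of_nonneg ht] at hfin
  have heq : B t t - B t 0 - B 0 t + B 0 0 = B t t - B 0 t - (B t 0 - B 0 0) := by ring
  rw [heq]
  exact hfin

-- Joint differentiability of `A` is not available. By symmetry, `a(x+tv) - 2A(x,x+tv) + A(x,x)` is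
-- the mixed second difference of `(t, r) ↦ A(x+tv, x+rv)`. It is `o(t)` by `mixed_difference_le`,
-- and dividing by `t` identifies the two derivatives.
open Filter Topology in
theorem fderiv_diagonal {d : ℕ} {D : Set (EuclideanSpace ℝ (Fin d))} (hD : IsOpen D)
    {A : EuclideanSpace ℝ (Fin d) → EuclideanSpace ℝ (Fin d) → ℝ}
    (hsymm : ∀ x ∈ D, ∀ y ∈ D, A x y = A y x) {K : ℝ} (hA : ∀ x ∈ D, HasC4Bound D K (A x))
    {x : EuclideanSpace ℝ (Fin d)} (hx : x ∈ D)
    (hdiff : DifferentiableAt ℝ (fun z => A z z) x) (v : EuclideanSpace ℝ (Fin d)) :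
    fderiv ℝ (fun z => A z z) x v = 2 * fderiv ℝ (A x) x v := by
  have hK : 0 ≤ K := (hA x hx).nonneg_of_mem hx
  have hcont : Tendsto (fun t : ℝ => x + t • v) (𝓝 0) (𝓝 x) := by
    have h : Continuous fun t : ℝ => x + t • v := by fun_prop
    simpa using h.tendsto 0
  obtain ⟨σ₁, hσ₁, hσ₁D⟩ := Metric.eventually_nhds_iff.1 (hcont.eventually (hD.mem_nhds hx))
  have hmem : ∀ t ∈ Icc 0 (σ₁ / 2), x + t • v ∈ D := by
    intro t ht
    refine hσ₁D ?_
    rw [Real.dist_eq, sub_zero, abs_of_nonneg ht.1]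
    linarith [ht.2]
  have hσ₀ : 0 < σ₁ / 2 := by positivity
  let L : ℝ := K * ‖v‖ + K * (‖v‖ * ‖v‖)
  have hL1 : K * ‖v‖ ≤ L := le_add_of_nonneg_right (by positivity)
  have hL2 : K * (‖v‖ * ‖v‖) ≤ L := le_add_of_nonneg_left (by positivity)
  have hcd : ∀ t ∈ Icc 0 (σ₁ / 2), ∀ r ∈ Icc 0 (σ₁ / 2),
      ContDiffAt ℝ 4 (A (x + t • v)) (x + r • v) := fun t ht r hr =>
    (hA _ (hmem t ht)).contDiffAt hD (hmem r hr)
  have hmix : ∀ σ t : ℝ, 0 < σ → σ ≤ σ₁ / 2 → 0 ≤ t → t ≤ σ →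
      |A (x + t • v) (x + t • v) - A (x + t • v) (x + (0 : ℝ) • v) -
        A (x + (0 : ℝ) • v) (x + t • v) + A (x + (0 : ℝ) • v) (x + (0 : ℝ) • v)| ≤
      (2 * L * t / σ + 2 * L * σ) * t := by
    intro σ t hσ hσσ ht htσ
    refine mixed_difference_le (B := fun t r => A (x + t • v) (x + r • v))
      (B1 := fun t r => fderiv ℝ (A (x + t • v)) (x + r • v) v)
      (B2 := fun t r => fderiv ℝ (fun y => fderiv ℝ (A (x + t • v)) y v) (x + r • v) v) hσ₀
      (fun t ht r hr => hsymm _ (hmem t ht) _ (hmem r hr)) (fun t ht r hr => ?_)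
      (fun t ht r hr => ?_) (fun t ht r hr => ?_) (fun t ht r hr => ?_) hσ hσσ ht htσ
    · exact hasDerivAt_comp_add_smul ((hcd t ht r hr).differentiableAt (by norm_num))
    · refine hasDerivAt_comp_add_smul (f := fun y => fderiv ℝ (A (x + t • v)) y v) ?_
      exact (((hcd t ht r hr).fderiv_right (m := 1) (by norm_num)).differentiableAt
        (by norm_num)).clm_apply (differentiableAt_const v)
    · have h1 := (hA _ (hmem t ht)).norm_iteratedFDeriv_le hD (k := 1) (by norm_num) (hmem r hr)
      rw [norm_iteratedFDeriv_one] at h1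
      rw [← Real.norm_eq_abs]
      exact ((ContinuousLinearMap.le_opNorm _ _).trans
        (mul_le_mul_of_nonneg_right h1 (norm_nonneg _))).trans hL1
    · have h1 := (hA _ (hmem t ht)).norm_iteratedFDeriv_le hD (k := 2) (by norm_num) (hmem r hr)
      have hd1 : DifferentiableAt ℝ (fderiv ℝ (A (x + t • v))) (x + r • v) :=
        ((hcd t ht r hr).fderiv_right (m := 1) (by norm_num)).differentiableAt (by norm_num)
      have h2 : fderiv ℝ (fun y => fderiv ℝ (A (x + t • v)) y v) (x + r • v) v =
          iteratedFDeriv ℝ 2 (A (x + t • v)) (x + r • v) (fun _ => v) := by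
        rw [iteratedFDeriv_two_apply, fderiv_clm_apply hd1 (differentiableAt_const v)]
        simp
      rw [h2, ← Real.norm_eq_abs]
      refine (ContinuousMultilinearMap.le_opNorm _ _).trans ?_
      rw [Fin.prod_univ_two]
      exact (mul_le_mul_of_nonneg_right h1 (by positivity)).trans hL2
  have h0 : x + (0 : ℝ) • v = x := by simp
  have hda : HasDerivAt (fun t : ℝ => A (x + t • v) (x + t • v)) (fderiv ℝ (fun z => A z z) x v) 0 := by
    have := hasDerivAt_comp_add_smul (f := fun z => A z z) (x := x) (v := v) (t := 0) (by rwa [h0])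
    rwa [h0] at this
  have hdA : HasDerivAt (fun t : ℝ => A x (x + t • v)) (fderiv ℝ (A x) x v) 0 := by
    have := hasDerivAt_comp_add_smul (f := A x) (x := x) (v := v) (t := 0)
      (by rw [h0]; exact ((hA x hx).contDiffAt hD hx).differentiableAt (by norm_num))
    rwa [h0] at this
  -- The derivatives exist two-sidedly, so the slope may be followed along `t > 0`, where the mixed
  -- difference estimate holds.
  have hlim := ((hda.sub (hdA.const_mul 2)).tendsto_slope_zero).mono_left
    (nhdsWithin_mono 0 (fun t (ht : t ∈ Ioi (0 : ℝ)) => ht.ne'))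
  have hlim0 : Tendsto (fun t : ℝ => t⁻¹ • (((fun t : ℝ => A (x + t • v) (x + t • v)) -
      fun t : ℝ => 2 * A x (x + t • v)) (0 + t) - ((fun t : ℝ => A (x + t • v) (x + t • v)) -
      fun t : ℝ => 2 * A x (x + t • v)) 0)) (𝓝[>] 0) (𝓝 0) := by
    rw [Metric.tendsto_nhds]
    intro η hη
    have hLnn : 0 ≤ L := by positivity
    -- First `σ` is fixed so that the term `2 * L * σ` is below `η / 2`; only then does `t → 0` make
    -- `2 * L * t / σ` small.
    obtain ⟨σ, hσ, hσσ, hση⟩ : ∃ σ : ℝ, 0 < σ ∧ σ ≤ σ₁ / 2 ∧ 2 * L * σ < η / 2 := by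
      refine ⟨min (σ₁ / 2) (η / (4 * (L + 1)) / 2), by positivity, min_le_left _ _, ?_⟩
      have h1 : 2 * L * min (σ₁ / 2) (η / (4 * (L + 1)) / 2) ≤ 2 * L * (η / (4 * (L + 1)) / 2) :=
        mul_le_mul_of_nonneg_left (min_le_right _ _) (by positivity)
      refine h1.trans_lt ?_
      rw [div_div, mul_div_assoc', div_lt_div_iff₀ (by positivity) (by positivity)]
      nlinarith
    have hev1 : ∀ᶠ t in 𝓝[>] (0 : ℝ), t < σ := nhdsWithin_le_nhds (gt_mem_nhds hσ)
    have hev2 : ∀ᶠ t in 𝓝[>] (0 : ℝ), 2 * L * t / σ < η / 2 := by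
      have h1 : Tendsto (fun t : ℝ => 2 * L * t / σ) (𝓝 0) (𝓝 (2 * L * 0 / σ)) :=
        (tendsto_id.const_mul _).div_const _
      rw [mul_zero, zero_div] at h1
      exact nhdsWithin_le_nhds (h1.eventually (gt_mem_nhds (by positivity)))
    filter_upwards [self_mem_nhdsWithin, hev1, hev2] with t (ht : 0 < t) ht1 ht2
    have h1 := hmix σ t hσ hσσ ht.le ht1.le
    rw [h0, hsymm (x + t • v) (hmem t ⟨ht.le, ht1.le.trans hσσ⟩) x hx] at h1
    simp only [Pi.sub_apply, zero_add, h0, dist_zero_right, norm_smul, norm_inv,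
      Real.norm_eq_abs, abs_of_pos ht]
    rw [inv_mul_lt_iff₀ ht]
    have h2 : A (x + t • v) (x + t • v) - 2 * A x (x + t • v) - (A x x - 2 * A x x) =
        A (x + t • v) (x + t • v) - A x (x + t • v) - A x (x + t • v) + A x x := by ring
    rw [h2]
    refine h1.trans_lt ?_
    rw [mul_comm]
    exact mul_lt_mul_of_pos_left (by linarith) ht
  have := tendsto_nhds_unique hlim hlim0
  linarith

/-- Expanding the divergence gives `a ∂ᵢ∂ᵢu + ∂ᵢa ∂ᵢu`, and `fderiv_diagonal` replaces `∂ᵢa` by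
twice the partial derivative of `A`. -/
theorem limitOperator_eq_neg_localOperator {d : ℕ} {D : Set (EuclideanSpace ℝ (Fin d))}
    (hD : IsOpen D) {A : EuclideanSpace ℝ (Fin d) → EuclideanSpace ℝ (Fin d) → ℝ}
    (hsymm : ∀ x ∈ D, ∀ y ∈ D, A x y = A y x) {K K' : ℝ} (hA : ∀ x ∈ D, HasC4Bound D K (A x))
    {u : EuclideanSpace ℝ (Fin d) → ℝ} (hu : HasC4Bound D K' u)
    {x : EuclideanSpace ℝ (Fin d)} (hx : x ∈ D)
    (hdiff : DifferentiableAt ℝ (fun z => A z z) x) :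
    limitOperator A u x = -localOperator (fun z => A z z) u x := by
  rw [limitOperator_eq hD hx (hA x hx) hu, localOperator, neg_neg]
  refine Finset.sum_congr rfl fun i _ => ?_
  have hdu : DifferentiableAt ℝ (fun y => fderiv ℝ u y (EuclideanSpace.single i 1)) x :=
    (((hu.contDiffAt hD hx).fderiv_right (m := 1) (by norm_num)).differentiableAt
      (by norm_num)).clm_apply (differentiableAt_const _)
  rw [fderiv_fun_mul hdiff hdu]
  simp only [add_apply, smul_apply, smul_eq_mul,
    fderiv_diagonal hD hsymm hA hx hdiff]
  ring

/-! ### The barrier -/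

/-- For `b = exp(l y₀)` the second-order term is of order `l²` and the first-order term of order
`l`, so a large `l` beats the drift, which is only known to be bounded. -/
theorem exists_barrier {d : ℕ} (hd : 0 < d) {D : Set (EuclideanSpace ℝ (Fin d))} (hD : IsOpen D)
    (hDb : Bornology.IsBounded D)
    {A : EuclideanSpace ℝ (Fin d) → EuclideanSpace ℝ (Fin d) → ℝ} {r K : ℝ} (hr : 0 < r)
    (hK : 0 ≤ K) (hlow : ∀ x ∈ D, ∀ y ∈ D, r ≤ A x y) (hA : ∀ x ∈ D, HasC4Bound D K (A x)) :
    ∃ (b : EuclideanSpace ℝ (Fin d) → ℝ) (c B : ℝ), 0 < c ∧ (∀ y, 0 ≤ b y) ∧ HasC4Bound D B b ∧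
      ∀ x ∈ D, c ≤ limitOperator A b x := by
  let i₀ : Fin d := ⟨0, hd⟩
  -- With this choice `A x x * l ≥ 2 * K + 1`, while the drift is at least `-2 * K`, so their sum is
  -- at least one.
  let l : ℝ := (2 * K + 1) / r
  have hl : 0 < l := by positivity
  let b : EuclideanSpace ℝ (Fin d) → ℝ := fun y => Real.exp (l * y i₀)
  have hbc : ContDiff ℝ 4 b := by
    have h : ContDiff ℝ 4 fun y : EuclideanSpace ℝ (Fin d) => y i₀ :=
      (EuclideanSpace.proj (𝕜 := ℝ) i₀).contDiff
    exact (contDiff_const.mul h).exp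
  obtain ⟨B, hB⟩ := isC4_of_contDiff hD hDb hbc
  obtain ⟨R, hR⟩ := hDb.exists_norm_le
  have hderiv : ∀ y e, fderiv ℝ b y e = l * e i₀ * b y := by
    intro y e
    have h1 : HasFDerivAt (fun y : EuclideanSpace ℝ (Fin d) => l * y i₀)
        (l • EuclideanSpace.proj (𝕜 := ℝ) i₀) y :=
      (EuclideanSpace.proj (𝕜 := ℝ) i₀).hasFDerivAt.const_mul l
    rw [show fderiv ℝ b y = _ from h1.exp.fderiv]
    simp [b]
    ring
  have hderiv2 : ∀ y e, fderiv ℝ (fun y => fderiv ℝ b y e) y e = (l * e i₀) ^ 2 * b y := by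
    intro y e
    simp_rw [hderiv]
    rw [fderiv_const_mul (hbc.differentiable (by norm_num) y)]
    simp only [smul_apply, hderiv, smul_eq_mul]
    ring
  refine ⟨b, l * Real.exp (-(l * R)), B, by positivity, fun y => (Real.exp_pos _).le, hB,
    fun x hx => ?_⟩
  rw [limitOperator_eq hD hx (hA x hx) hB]
  simp only [hderiv2]
  simp only [hderiv]
  rw [Finset.sum_eq_single i₀]
  · simp only [PiLp.single_apply, if_true, mul_one]
    have h1 := (hA x hx).norm_iteratedFDeriv_le hD (k := 1) (by norm_num) hx
    rw [norm_iteratedFDeriv_one] at h1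
    have h2 : |fderiv ℝ (A x) x (EuclideanSpace.single i₀ 1)| ≤ K := by
      have := (ContinuousLinearMap.le_opNorm (fderiv ℝ (A x) x) (EuclideanSpace.single i₀ 1))
      rw [PiLp.norm_single, norm_one, mul_one] at this
      exact this.trans h1
    have h3 : r * l = 2 * K + 1 := mul_div_cancel₀ _ hr.ne'
    have h4 := hlow x hx x hx
    have h5 : 1 ≤ A x x * l + 2 * fderiv ℝ (A x) x (EuclideanSpace.single i₀ 1) := by
      have := mul_le_mul_of_nonneg_right h4 hl.le
      linarith [(abs_le.1 h2).1]
    have h6 : Real.exp (-(l * R)) ≤ b x := by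
      refine Real.exp_le_exp.2 ?_
      have h7 := (PiLp.norm_apply_le x i₀).trans (hR x hx)
      have h8 := (abs_le.1 h7).1
      nlinarith
    have hb : 0 < b x := Real.exp_pos _
    calc l * Real.exp (-(l * R)) ≤ l * b x := mul_le_mul_of_nonneg_left h6 hl.le
      _ ≤ l * b x * (A x x * l + 2 * fderiv ℝ (A x) x (EuclideanSpace.single i₀ 1)) :=
        le_mul_of_one_le_right (by positivity) h5
      _ = _ := by ring
  · intro i _ hi
    have : (EuclideanSpace.single i (1 : ℝ) : EuclideanSpace ℝ (Fin d)) i₀ = 0 := by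
      simp [hi.symm]
    rw [this]
    ring
  · simp

/-! ### Maximum principles and stability -/

theorem discreteOperator_add_mul {d : ℕ} {Ω : Set (EuclideanSpace ℝ (Fin d))}
    {A : EuclideanSpace ℝ (Fin d) → EuclideanSpace ℝ (Fin d) → ℝ} {γ₁ : ℝ → ℝ} {δ h : ℝ}
    {wt : EuclideanSpace ℝ (Fin d) → EuclideanSpace ℝ (Fin d) → ℝ} {x : EuclideanSpace ℝ (Fin d)}
    (hfin : (neighbors Ω δ h x).Finite) (u v : EuclideanSpace ℝ (Fin d) → ℝ) (t : ℝ) :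
    discreteOperator Ω A γ₁ δ h wt (fun y => u y + t * v y) x =
      discreteOperator Ω A γ₁ δ h wt u x + t * discreteOperator Ω A γ₁ δ h wt v x := by
  simp only [discreteOperator, finsum_mem_eq_finite_toFinset_sum _ hfin]
  rw [mul_left_comm t, ← mul_add, Finset.mul_sum (a := t), ← Finset.sum_add_distrib]
  congr 1
  exact Finset.sum_congr rfl fun y _ => by ring

theorem nonlocalOperator_add_mul {d : ℕ}
    {A : EuclideanSpace ℝ (Fin d) → EuclideanSpace ℝ (Fin d) → ℝ} {γ₁ : ℝ → ℝ} {δ : ℝ}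
    {x : EuclideanSpace ℝ (Fin d)} {u v : EuclideanSpace ℝ (Fin d) → ℝ}
    (hu : Integrable (fun y => A x y * rescaledKernel d γ₁ δ ‖x - y‖ * (u y - u x)))
    (hv : Integrable (fun y => A x y * rescaledKernel d γ₁ δ ‖x - y‖ * (v y - v x))) (t : ℝ) :
    Integrable (fun y => A x y * rescaledKernel d γ₁ δ ‖x - y‖ *
        ((u y + t * v y) - (u x + t * v x))) ∧
      nonlocalOperator A γ₁ δ (fun y => u y + t * v y) x =
        nonlocalOperator A γ₁ δ u x + t * nonlocalOperator A γ₁ δ v x := by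
  have h : (fun y => A x y * rescaledKernel d γ₁ δ ‖x - y‖ * ((u y + t * v y) - (u x + t * v x))) =
      fun y => A x y * rescaledKernel d γ₁ δ ‖x - y‖ * (u y - u x) +
        t * (A x y * rescaledKernel d γ₁ δ ‖x - y‖ * (v y - v x)) := by
    ext y
    ring
  constructor
  · rw [h]
    exact hu.add (hv.const_mul t)
  · rw [nonlocalOperator, h, integral_add hu (hv.const_mul t), integral_const_mul,
      nonlocalOperator, nonlocalOperator]
    ring

/-- The discrete maximum principle: a strict discrete subsolution is bounded by its boundary
values. -/
theorem discrete_maximum_principle {d : ℕ} (hd : 0 < d) {s : ℝ} {γ₁ : ℝ → ℝ}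
    (hγ : IsKernelProfile d s γ₁) {Ω D : Set (EuclideanSpace ℝ (Fin d))} {δ h : ℝ} (hδ : 0 < δ)
    (hfin : (grid Ω δ h).Finite) (hΩD : extendedDomain Ω δ ⊆ D)
    {A : EuclideanSpace ℝ (Fin d) → EuclideanSpace ℝ (Fin d) → ℝ}
    (hApos : ∀ x ∈ D, ∀ y ∈ D, 0 < A x y)
    {wt : EuclideanSpace ℝ (Fin d) → EuclideanSpace ℝ (Fin d) → ℝ}
    (hwt : ∀ x ∈ grid Ω δ h ∩ Ω, ∀ y ∈ neighbors Ω δ h x, 0 < wt y x)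
    {φ : EuclideanSpace ℝ (Fin d) → ℝ} {M : ℝ}
    (hsub : ∀ x ∈ grid Ω δ h ∩ Ω, 0 < discreteOperator Ω A γ₁ δ h wt φ x)
    (hbd : ∀ x ∈ grid Ω δ h ∩ nonlocalBoundary Ω δ, φ x ≤ M) :
    ∀ x ∈ grid Ω δ h, φ x ≤ M := by
  intro x hx
  obtain ⟨z, hz, hmax⟩ := Set.exists_max_image _ φ hfin ⟨x, hx⟩
  refine (hmax x hx).trans ?_
  rcases hz.2 with hzΩ | hzb
  -- At an interior maximum every summand is nonpositive, against the strict sign. Strictness makes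
  -- any connectivity of the grid unnecessary.
  · exfalso
    have hnf : (neighbors Ω δ h z).Finite := hfin.subset neighbors_subset_grid
    refine (hsub z ⟨hz, hzΩ⟩).not_ge ?_
    rw [discreteOperator, finsum_mem_eq_finite_toFinset_sum _ hnf]
    refine mul_nonpos_of_nonneg_of_nonpos zero_le_two (Finset.sum_nonpos fun y hy => ?_)
    rw [hnf.mem_toFinset] at hy
    have hyg := neighbors_subset_grid hy
    refine mul_nonpos_of_nonpos_of_nonneg (mul_nonpos_of_nonneg_of_nonpos ?_ ?_)
      (hwt z ⟨hz, hzΩ⟩ y hy).le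
    · exact mul_nonneg (hApos z (hΩD hz.2) y (hΩD hyg.2)).le
        (rescaledKernel_pos_of_mem_neighbors hd hγ hδ hy).le
    · exact sub_nonpos.2 (hmax y hyg)
  · exact hbd z ⟨hz, hzb⟩

/-- The nonlocal maximum principle for bounded, not necessarily continuous, functions. -/
theorem nonlocal_maximum_principle {d : ℕ} (hd : 0 < d) {s : ℝ} (hs : s < d) {γ₁ : ℝ → ℝ}
    (hγ : IsKernelProfile d s γ₁) {Ω D : Set (EuclideanSpace ℝ (Fin d))} {δ : ℝ} (hδ : 0 < δ)
    (hball : ∀ x ∈ Ω, Metric.ball x δ ⊆ extendedDomain Ω δ) (hΩD : extendedDomain Ω δ ⊆ D)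
    {A : EuclideanSpace ℝ (Fin d) → EuclideanSpace ℝ (Fin d) → ℝ} {R : ℝ}
    (hApos : ∀ x ∈ D, ∀ y ∈ D, 0 < A x y) (hAR : ∀ x ∈ D, ∀ y ∈ D, A x y ≤ R)
    {φ : EuclideanSpace ℝ (Fin d) → ℝ} {M m : ℝ} (hm : 0 < m)
    (hint : ∀ x ∈ Ω, Integrable (fun y => A x y * rescaledKernel d γ₁ δ ‖x - y‖ * (φ y - φ x)))
    (hsub : ∀ x ∈ Ω, m ≤ nonlocalOperator A γ₁ δ φ x)
    (hbdd : BddAbove (φ '' extendedDomain Ω δ))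
    (hbd : ∀ x ∈ nonlocalBoundary Ω δ, φ x ≤ M) :
    ∀ x ∈ extendedDomain Ω δ, φ x ≤ M := by
  by_contra! hcon
  obtain ⟨x₀, hx₀, hx₀M⟩ := hcon
  set S := sSup (φ '' extendedDomain Ω δ) with hS
  have hle : ∀ y ∈ extendedDomain Ω δ, φ y ≤ S := fun y hy => le_csSup hbdd ⟨y, hy, rfl⟩
  have hMS : M < S := hx₀M.trans_le (hle x₀ hx₀)
  have hR : 0 ≤ R := (hApos x₀ (hΩD hx₀) x₀ (hΩD hx₀)).le.trans (hAR x₀ (hΩD hx₀) x₀ (hΩD hx₀))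
  -- The total mass of the kernel, the same at every point. It depends on `δ`, but it enters only
  -- the choice of `ε` and not the conclusion.
  set J : ℝ := 1 / δ ^ 2 * ∫ z : EuclideanSpace ℝ (Fin d) in Metric.ball 0 1, 1 * γ₁ ‖z‖ with hJ
  have hJx : ∀ x : EuclideanSpace ℝ (Fin d),
      ∫ y in Metric.ball x δ, rescaledKernel d γ₁ δ ‖x - y‖ = J := by
    intro x
    have := setIntegral_ball_rescaledKernel γ₁ hδ x (fun _ => 1)
    rw [hJ, ← this]
    simp
  have hJ0 : 0 ≤ J := by
    refine mul_nonneg (by positivity) (setIntegral_nonneg_of_ae_restrict ?_)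
    filter_upwards [ae_restrict_of_ae (ae_ne_zero_and_norm_ne_one hd)] with z hz
    simpa using hγ.nonneg _ (norm_pos_iff.2 hz.1)
  -- The supremum need not be attained, so a point within `ε` of it is used. The first condition on
  -- `ε` forces that point into `Ω`; the second contradicts the lower bound `m`, since no value of
  -- `φ` exceeds that at the point by more than `ε`.
  obtain ⟨ε, hε, hεS, hεm⟩ : ∃ ε : ℝ, 0 < ε ∧ ε ≤ S - M ∧ 2 * (R * ε * J) < m := by
    refine ⟨min (S - M) (m / (2 * R * J + 1)), lt_min (sub_pos.2 hMS) (by positivity),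
      min_le_left _ _, ?_⟩
    have h1 : 2 * R * J * min (S - M) (m / (2 * R * J + 1)) ≤ 2 * R * J * (m / (2 * R * J + 1)) :=
      mul_le_mul_of_nonneg_left (min_le_right _ _) (by positivity)
    have h2 : 2 * R * J * (m / (2 * R * J + 1)) < m := by
      rw [mul_div_assoc', div_lt_iff₀ (by positivity)]
      nlinarith
    linarith
  obtain ⟨_, ⟨x, hx, rfl⟩, hxS⟩ := exists_lt_of_lt_csSup (Set.Nonempty.image φ ⟨x₀, hx₀⟩)
    (show S - ε < sSup (φ '' extendedDomain Ω δ) by linarith)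
  have hxΩ : x ∈ Ω := by
    rcases hx with hx | hx
    · exact hx
    · linarith [hbd x hx]
  have h1 : nonlocalOperator A γ₁ δ φ x ≤ 2 * (R * ε * J) := by
    rw [nonlocalOperator, ← hJx x, ← integral_const_mul (R * ε),
      ← setIntegral_eq_integral_of_forall_compl_eq_zero (s := Metric.ball x δ)]
    · refine mul_le_mul_of_nonneg_left ?_ zero_le_two
      refine integral_mono_ae (hint x hxΩ).integrableOn
        ((integrableOn_ball_rescaledKernel hd hs hγ hδ x).const_mul _) ?_
      have : Nonempty (Fin d) := ⟨⟨0, hd⟩⟩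
      have hne : ∀ᵐ y : EuclideanSpace ℝ (Fin d), y ≠ x := by simp [ae_iff]
      filter_upwards [ae_restrict_of_ae hne, ae_restrict_mem measurableSet_ball] with y hyx hy
      have hk : 0 ≤ rescaledKernel d γ₁ δ ‖x - y‖ :=
        rescaledKernel_nonneg hγ hδ (norm_pos_iff.2 (sub_ne_zero.2 hyx.symm))
      have hyD := hball x hxΩ hy
      have hA0 := hApos x (hΩD hx) y (hΩD hyD)
      have hA1 := hAR x (hΩD hx) y (hΩD hyD)
      have h2 : φ y - φ x ≤ ε := by linarith [hle y hyD]
      calc A x y * rescaledKernel d γ₁ δ ‖x - y‖ * (φ y - φ x)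
          ≤ A x y * rescaledKernel d γ₁ δ ‖x - y‖ * ε :=
            mul_le_mul_of_nonneg_left h2 (mul_nonneg hA0.le hk)
        _ = A x y * (rescaledKernel d γ₁ δ ‖x - y‖ * ε) := by ring
        _ ≤ R * (rescaledKernel d γ₁ δ ‖x - y‖ * ε) :=
            mul_le_mul_of_nonneg_right hA1 (mul_nonneg hk hε.le)
        _ = _ := by ring
    · intro y hy
      rw [rescaledKernel_eq_zero_of_notMem_ball hγ hδ hy, mul_zero, zero_mul]
  linarith [hsub x hxΩ]

/-- Adding `2 * m / c` times the barrier raises the operator from at least `-m` to at least `m > 0`.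
The maximum principle then bounds the sum by the boundary values of the added barrier, and the
argument is repeated for `-e`. -/
theorem discrete_stability {d : ℕ} (hd : 0 < d) {s : ℝ} {γ₁ : ℝ → ℝ}
    (hγ : IsKernelProfile d s γ₁) {Ω D : Set (EuclideanSpace ℝ (Fin d))} {δ h : ℝ} (hδ : 0 < δ)
    (hfin : (grid Ω δ h).Finite) (hΩD : extendedDomain Ω δ ⊆ D)
    {A : EuclideanSpace ℝ (Fin d) → EuclideanSpace ℝ (Fin d) → ℝ}
    (hApos : ∀ x ∈ D, ∀ y ∈ D, 0 < A x y)
    {wt : EuclideanSpace ℝ (Fin d) → EuclideanSpace ℝ (Fin d) → ℝ}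
    (hwt : ∀ x ∈ grid Ω δ h ∩ Ω, ∀ y ∈ neighbors Ω δ h x, 0 < wt y x)
    {b : EuclideanSpace ℝ (Fin d) → ℝ} {c B : ℝ} (hc : 0 < c) (hb0 : ∀ y, 0 ≤ b y)
    (hbB : ∀ y ∈ D, b y ≤ B)
    (hbL : ∀ x ∈ grid Ω δ h ∩ Ω, c ≤ discreteOperator Ω A γ₁ δ h wt b x)
    {e : EuclideanSpace ℝ (Fin d) → ℝ} {m : ℝ} (hm : 0 < m)
    (he : ∀ x ∈ grid Ω δ h ∩ Ω, |discreteOperator Ω A γ₁ δ h wt e x| ≤ m)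
    (hbd : ∀ x ∈ grid Ω δ h ∩ nonlocalBoundary Ω δ, e x = 0) :
    ∀ x ∈ grid Ω δ h, |e x| ≤ 2 * m / c * B := by
  have hmc : 0 < 2 * m / c := by positivity
  have key : ∀ g : EuclideanSpace ℝ (Fin d) → ℝ,
      (∀ x ∈ grid Ω δ h ∩ Ω, -m ≤ discreteOperator Ω A γ₁ δ h wt g x) →
      (∀ x ∈ grid Ω δ h ∩ nonlocalBoundary Ω δ, g x = 0) →
      ∀ x ∈ grid Ω δ h, g x ≤ 2 * m / c * B := by
    intro g hg hg0 x hx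
    have h1 := discrete_maximum_principle hd hγ hδ hfin hΩD hApos hwt
      (φ := fun y => g y + 2 * m / c * b y) (M := 2 * m / c * B) (fun z hz => ?_) (fun z hz => ?_)
      x hx
    · have := mul_nonneg hmc.le (hb0 x)
      linarith
    · rw [discreteOperator_add_mul (hfin.subset neighbors_subset_grid)]
      have h2 := mul_le_mul_of_nonneg_left (hbL z hz) hmc.le
      rw [div_mul_cancel₀ _ hc.ne'] at h2
      linarith [hg z hz]
    · rw [hg0 z hz, zero_add]
      exact mul_le_mul_of_nonneg_left (hbB z (hΩD hz.1.2)) hmc.le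
  have hneg : ∀ x, discreteOperator Ω A γ₁ δ h wt (fun y => 0 + (-1) * e y) x =
      -discreteOperator Ω A γ₁ δ h wt e x := by
    intro x
    rw [discreteOperator_add_mul (hfin.subset neighbors_subset_grid) (fun _ => 0)]
    simp [discreteOperator]
  intro x hx
  rw [abs_le']
  constructor
  · exact key e (fun z hz => (abs_le.1 (he z hz)).1) hbd x hx
  · have := key (fun y => 0 + (-1) * e y)
      (fun z hz => by rw [hneg]; exact neg_le_neg (abs_le.1 (he z hz)).2)
      (fun z hz => by simp [hbd z hz]) x hx
    linarith

/-- The barrier argument again, here with the quantitative gap `m` that the maximum principle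
without attained maxima needs. The bound `E` only makes the supremum finite and does not enter the
estimate. -/
theorem nonlocal_stability {d : ℕ} (hd : 0 < d) {s : ℝ} (hs : s < d) {γ₁ : ℝ → ℝ}
    (hγ : IsKernelProfile d s γ₁) {Ω D : Set (EuclideanSpace ℝ (Fin d))} {δ : ℝ} (hδ : 0 < δ)
    (hball : ∀ x ∈ Ω, Metric.ball x δ ⊆ extendedDomain Ω δ) (hΩD : extendedDomain Ω δ ⊆ D)
    {A : EuclideanSpace ℝ (Fin d) → EuclideanSpace ℝ (Fin d) → ℝ} {R : ℝ}
    (hApos : ∀ x ∈ D, ∀ y ∈ D, 0 < A x y) (hAR : ∀ x ∈ D, ∀ y ∈ D, A x y ≤ R)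
    {b : EuclideanSpace ℝ (Fin d) → ℝ} {c B : ℝ} (hc : 0 < c) (hb0 : ∀ y, 0 ≤ b y)
    (hbB : ∀ y ∈ D, b y ≤ B)
    (hbint : ∀ x ∈ Ω, Integrable (fun y => A x y * rescaledKernel d γ₁ δ ‖x - y‖ * (b y - b x)))
    (hbL : ∀ x ∈ Ω, c ≤ nonlocalOperator A γ₁ δ b x)
    {e : EuclideanSpace ℝ (Fin d) → ℝ} {m E : ℝ} (hm : 0 < m)
    (heint : ∀ x ∈ Ω, Integrable (fun y => A x y * rescaledKernel d γ₁ δ ‖x - y‖ * (e y - e x)))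
    (he : ∀ x ∈ Ω, |nonlocalOperator A γ₁ δ e x| ≤ m)
    (heE : ∀ x ∈ extendedDomain Ω δ, |e x| ≤ E)
    (hbd : ∀ x ∈ nonlocalBoundary Ω δ, e x = 0) :
    ∀ x ∈ extendedDomain Ω δ, |e x| ≤ 2 * m / c * B := by
  have hmc : 0 < 2 * m / c := by positivity
  have key : ∀ g : EuclideanSpace ℝ (Fin d) → ℝ,
      (∀ x ∈ Ω, Integrable (fun y => A x y * rescaledKernel d γ₁ δ ‖x - y‖ * (g y - g x))) →
      (∀ x ∈ Ω, -m ≤ nonlocalOperator A γ₁ δ g x) →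
      (∀ x ∈ extendedDomain Ω δ, g x ≤ E) → (∀ x ∈ nonlocalBoundary Ω δ, g x = 0) →
      ∀ x ∈ extendedDomain Ω δ, g x ≤ 2 * m / c * B := by
    intro g hgint hg hgE hg0 x hx
    have h1 := nonlocal_maximum_principle hd hs hγ hδ hball hΩD hApos hAR
      (φ := fun y => g y + 2 * m / c * b y) (M := 2 * m / c * B) hm
      (fun z hz => (nonlocalOperator_add_mul (hgint z hz) (hbint z hz) _).1) (fun z hz => ?_)
      ⟨E + 2 * m / c * B, ?_⟩ (fun z hz => ?_) x hx
    · have := mul_nonneg hmc.le (hb0 x)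
      linarith
    · rw [(nonlocalOperator_add_mul (hgint z hz) (hbint z hz) _).2]
      have h2 := mul_le_mul_of_nonneg_left (hbL z hz) hmc.le
      rw [div_mul_cancel₀ _ hc.ne'] at h2
      linarith [hg z hz]
    · rintro _ ⟨y, hy, rfl⟩
      exact add_le_add (hgE y hy) (mul_le_mul_of_nonneg_left (hbB y (hΩD hy)) hmc.le)
    · rw [hg0 z hz, zero_add]
      exact mul_le_mul_of_nonneg_left (hbB z (hΩD (Or.inr hz))) hmc.le
  have hneg := fun x hx => nonlocalOperator_add_mul (A := A) (γ₁ := γ₁) (δ := δ) (x := x)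
    (u := fun _ => 0) (by simp) (heint x hx) (-1)
  intro x hx
  rw [abs_le']
  constructor
  · exact key e heint (fun z hz => (abs_le.1 (he z hz)).1)
      (fun z hz => (abs_le.1 (heE z hz)).2) hbd x hx
  · have := key (fun y => 0 + (-1) * e y) (fun z hz => (hneg z hz).1)
      (fun z hz => by
        rw [(hneg z hz).2]
        have h1 : nonlocalOperator A γ₁ δ (fun _ => 0) z = 0 := by simp [nonlocalOperator]
        linarith [(abs_le.1 (he z hz)).2])
      (fun z hz => by linarith [(abs_le.1 (heE z hz)).1])
      (fun z hz => by simp [hbd z hz]) x hx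
    linarith

/-! ### Solvability of the discrete problem -/

/-- A discrete operator that satisfies a uniqueness principle is uniquely solvable. -/
theorem exists_isDiscreteSolution {d : ℕ} {Ω : Set (EuclideanSpace ℝ (Fin d))}
    {A : EuclideanSpace ℝ (Fin d) → EuclideanSpace ℝ (Fin d) → ℝ} {γ₁ : ℝ → ℝ} {δ h : ℝ}
    {wt : EuclideanSpace ℝ (Fin d) → EuclideanSpace ℝ (Fin d) → ℝ} (hfin : (grid Ω δ h).Finite)
    (huniq : ∀ e : EuclideanSpace ℝ (Fin d) → ℝ,
      (∀ x ∈ grid Ω δ h ∩ Ω, discreteOperator Ω A γ₁ δ h wt e x = 0) →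
      (∀ x ∈ grid Ω δ h ∩ nonlocalBoundary Ω δ, e x = 0) → ∀ x ∈ grid Ω δ h, e x = 0)
    (f uD : EuclideanSpace ℝ (Fin d) → ℝ) :
    ∃ u, IsDiscreteSolution Ω A γ₁ δ h wt f uD u := by
  classical
  have hG : (grid Ω δ h ∩ Ω).Finite := hfin.subset inter_subset_left
  have : Finite ↥(grid Ω δ h ∩ Ω) := hG
  let ext : (↥(grid Ω δ h ∩ Ω) → ℝ) → EuclideanSpace ℝ (Fin d) → ℝ := fun v y =>
    if hy : y ∈ grid Ω δ h ∩ Ω then v ⟨y, hy⟩ else 0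
  have hadd : ∀ (u v : EuclideanSpace ℝ (Fin d) → ℝ) (t : ℝ) (x : EuclideanSpace ℝ (Fin d)),
      discreteOperator Ω A γ₁ δ h wt (fun y => u y + t * v y) x =
        discreteOperator Ω A γ₁ δ h wt u x + t * discreteOperator Ω A γ₁ δ h wt v x :=
    fun u v t x => discreteOperator_add_mul (hfin.subset neighbors_subset_grid) u v t
  have hzero : ∀ x, discreteOperator Ω A γ₁ δ h wt (fun _ => 0) x = 0 := by
    intro x
    simp [discreteOperator]
  let T : (↥(grid Ω δ h ∩ Ω) → ℝ) →ₗ[ℝ] (↥(grid Ω δ h ∩ Ω) → ℝ) :=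
    { toFun := fun v x => discreteOperator Ω A γ₁ δ h wt (ext v) x
      map_add' := fun v w => by
        funext x
        have h1 : ext (v + w) = fun y => ext v y + 1 * ext w y := by
          funext y
          by_cases hy : y ∈ grid Ω δ h ∩ Ω
          · simp only [ext, dif_pos hy, Pi.add_apply, one_mul]
          · simp only [ext, dif_neg hy, mul_zero, add_zero]
        rw [h1, hadd, one_mul]
        rfl
      map_smul' := fun t v => by
        funext x
        have h1 : ext (t • v) = fun y => 0 + t * ext v y := by
          funext y
          by_cases hy : y ∈ grid Ω δ h ∩ Ω
          · simp only [ext, dif_pos hy, Pi.smul_apply, smul_eq_mul, zero_add]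
          · simp only [ext, dif_neg hy, mul_zero, add_zero]
        rw [h1, hadd (fun _ => 0), hzero, zero_add]
        rfl }
  -- The extension by zero has zero boundary values, so the uniqueness principle applies. On a
  -- finite-dimensional space injectivity gives surjectivity.
  have hinj : Function.Injective T := by
    rw [injective_iff_map_eq_zero]
    intro v hv
    have h1 := huniq (ext v) (fun x hx => congrFun hv ⟨x, hx⟩)
      (fun x hx => dif_neg fun h => hx.2.1 h.2)
    funext x
    have h2 := h1 x x.2.1
    simp only [ext, dif_pos x.2] at h2
    exact h2
  -- A lift of the boundary data, vanishing in `Ω`; its contribution is moved to the right-hand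
  -- side.
  let g : EuclideanSpace ℝ (Fin d) → ℝ := fun y => if y ∈ Ω then 0 else uD y
  obtain ⟨v, hv⟩ := (LinearMap.injective_iff_surjective.1 hinj)
    fun x => -f x - discreteOperator Ω A γ₁ δ h wt g x
  refine ⟨fun y => ext v y + 1 * g y, fun x hx => ?_, fun x hx => ?_⟩
  · have h1 : discreteOperator Ω A γ₁ δ h wt (ext v) x =
        -f x - discreteOperator Ω A γ₁ δ h wt g x := congrFun hv ⟨x, hx⟩
    rw [hadd, h1]
    ring
  · have h1 : ext v x = 0 := dif_neg fun h => hx.2.1 h.2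
    have h2 : g x = uD x := if_neg hx.2.1
    rw [h1, h2]
    ring

/-! ### Assembly of the error estimates -/

theorem mainTheorem5
    (d : ℕ) (hd : 0 < d) (s : ℝ) (hs : s < d)
    (γ₁ : ℝ → ℝ) (hγ : IsKernelProfile d s γ₁)
    (Ω : Set (EuclideanSpace ℝ (Fin d))) (hΩo : IsOpen Ω) (hΩb : Bornology.IsBounded Ω)
    (hΩn : Ω.Nonempty)
    (δbar : ℝ) (hδbar : 0 < δbar)
    (A : EuclideanSpace ℝ (Fin d) → EuclideanSpace ℝ (Fin d) → ℝ) (r R : ℝ)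
    (hA : IsDiffusionCoefficient (extendedDomain Ω δbar) r R A)
    (ha : ContDiffOn ℝ ∞ (fun x => A x x) Ω)
    (f uD u0 : EuclideanSpace ℝ (Fin d) → ℝ)
    (hu0 : IsLocalSolution Ω (fun x => A x x) f uD u0)
    (hu0D : ∀ x ∈ nonlocalBoundary Ω δbar, u0 x = uD x)
    (hu0C4 : IsC4 (extendedDomain Ω δbar) u0) :
    (∃ Cpos : ℝ, IsPositivityConstant Ω γ₁ Cpos) ∧
    ∀ Cpos : ℝ, IsPositivityConstant Ω γ₁ Cpos →
      ∃ δ₀ : ℝ, 0 < δ₀ ∧ δ₀ ≤ δbar ∧ ∃ C : ℝ, 0 < C ∧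
        ∀ ρ : ℝ, 0 < ρ → ρ < Cpos → ∀ δ : ℝ, 0 < δ → δ < δ₀ →
          ∀ wt : EuclideanSpace ℝ (Fin d) → EuclideanSpace ℝ (Fin d) → ℝ,
            IsWeightFamily Ω γ₁ δ (ρ * δ) wt →
            ∃ uh : EuclideanSpace ℝ (Fin d) → ℝ,
              IsDiscreteSolution Ω A γ₁ δ (ρ * δ) wt f uD uh ∧
              (∀ v : EuclideanSpace ℝ (Fin d) → ℝ,
                IsDiscreteSolution Ω A γ₁ δ (ρ * δ) wt f uD v →
                EqOn v uh (grid Ω δ (ρ * δ))) ∧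
              (∀ uδ : EuclideanSpace ℝ (Fin d) → ℝ,
                IsNonlocalSolution Ω A γ₁ δ f uD uδ → IsC4 Ω uδ →
                ∀ x ∈ grid Ω δ (ρ * δ), |uh x - uδ x| ≤ C * δ ^ 2) ∧
              (∀ x ∈ grid Ω δ (ρ * δ), |uh x - u0 x| ≤ C * δ ^ 2) := by
  refine ⟨exists_isPositivityConstant hd hs hγ hΩb hΩn, fun Cpos hCpos => ?_⟩
  set D := extendedDomain Ω δbar with hDdef
  have hD : IsOpen D := isOpen_extendedDomain hd hΩb hΩn hδbar
  have hDb : Bornology.IsBounded D := isBounded_extendedDomain hd hΩb hΩn hδbar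
  have hΩsub : Ω ⊆ D := subset_union_left
  obtain ⟨x₁, hx₁⟩ := hΩn
  have hΩn : Ω.Nonempty := ⟨x₁, hx₁⟩
  obtain ⟨K, hAK⟩ := hA.smooth
  obtain ⟨K', huK⟩ := hu0C4
  have hK0 : 0 ≤ K := (hAK x₁ (hΩsub hx₁)).nonneg_of_mem (hΩsub hx₁)
  have hK'0 : 0 ≤ K' := huK.nonneg_of_mem (hΩsub hx₁)
  have hApos : ∀ x ∈ D, ∀ y ∈ D, 0 < A x y := fun x hx y hy => hA.pos.trans_le (hA.lower x hx y hy)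
  obtain ⟨b, c, B, hc, hb0, hbB, hbL⟩ := exists_barrier hd hD hDb hA.pos hK0 hA.lower hAK
  have hbB' : ∀ y ∈ D, b y ≤ B := fun y hy => (le_abs_self _).trans (hbB.abs_le hy)
  have hB0 : 0 ≤ B := hbB.nonneg_of_mem (hΩsub hx₁)
  have hlim : ∀ x ∈ Ω, limitOperator A u0 x = -f x := by
    intro x hx
    rw [limitOperator_eq_neg_localOperator hD hA.symm hAK huK (hΩsub hx)
      ((ha.contDiffAt (hΩo.mem_nhds hx)).differentiableAt (by simp)), hu0.equation x hx]
  set Cb := 64 * d * K * B with hCb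
  set Cu := 64 * d * K * K' + 1 with hCu
  have hCb0 : 0 ≤ Cb := by positivity
  have hCu0 : 0 < Cu := by positivity
  set C := 2 * Cu / (c / 2) * B + 1 with hCdef
  have hC0 : 0 < C := by positivity
  -- Since `δ < 1`, the last bound gives `Cb * δ ^ 2 ≤ c / 2`, so the consistency error leaves at
  -- least half of the lower bound `c` of the barrier. The final constant is `2 * C` because the
  -- comparison of `uh` with `uδ` passes through `u0`.
  refine ⟨min (min δbar 1) (c / (2 * (Cb + 1))), by positivity,
    (min_le_left _ _).trans (min_le_left _ _), 2 * C, by positivity, ?_⟩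
  intro ρ hρ hρC δ hδ hδδ wt hwt
  have hδbar' : δ < δbar := hδδ.trans_le ((min_le_left _ _).trans (min_le_left _ _))
  have hδ1 : δ < 1 := hδδ.trans_le ((min_le_left _ _).trans (min_le_right _ _))
  have hδc : Cb * δ ^ 2 ≤ c / 2 := by
    have h1 : δ < c / (2 * (Cb + 1)) := hδδ.trans_le (min_le_right _ _)
    rw [lt_div_iff₀ (by positivity)] at h1
    nlinarith
  have hh : 0 < ρ * δ := by positivity
  have hfin := finite_grid hd hΩb hΩn hδ hh
  have hsubD : extendedDomain Ω δ ⊆ D := extendedDomain_mono hδbar'.le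
  have hball : ∀ x ∈ Ω, Metric.ball x δ ⊆ extendedDomain Ω δ := fun x hx =>
    ball_subset_extendedDomain hd hΩb hΩn hδ hx
  have hballD : ∀ x ∈ Ω, Metric.ball x δ ⊆ D := fun x hx => (hball x hx).trans hsubD
  have hwpos : ∀ x ∈ grid Ω δ (ρ * δ) ∩ Ω, ∀ y ∈ neighbors Ω δ (ρ * δ) x, 0 < wt y x :=
    fun x hx => (hCpos.2 δ (ρ * δ) hδ hh (mul_lt_mul_of_pos_right hρC hδ) x hx).2.2 _ (hwt x hx)
  have hdisc : ∀ {u : EuclideanSpace ℝ (Fin d) → ℝ} {L : ℝ}, HasC4Bound D L u →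
      ∀ x ∈ grid Ω δ (ρ * δ) ∩ Ω,
      |discreteOperator Ω A γ₁ δ (ρ * δ) wt u x - limitOperator A u x| ≤
        64 * d * K * L * δ ^ 2 := fun hu x hx =>
    abs_discreteOperator_sub_limitOperator_le hd hs hγ hD hδ (hballD x hx.2)
      (hAK x (hΩsub hx.2)) hu (hfin.subset neighbors_subset_grid) (hwt x hx).1 (hwpos x hx)
  have hnonl : ∀ {u : EuclideanSpace ℝ (Fin d) → ℝ} {L : ℝ}, HasC4Bound D L u → ∀ x ∈ Ω,
      |nonlocalOperator A γ₁ δ u x - limitOperator A u x| ≤ 64 * d * K * L * δ ^ 2 :=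
    fun hu x hx => abs_nonlocalOperator_sub_limitOperator_le hd hs hγ hD hδ (hballD x hx)
      (hAK x (hΩsub hx)) hu
  have hint : ∀ {u : EuclideanSpace ℝ (Fin d) → ℝ} {L : ℝ}, HasC4Bound D L u → ∀ x ∈ Ω,
      Integrable (fun y => A x y * rescaledKernel d γ₁ δ ‖x - y‖ * (u y - u x)) :=
    fun hu x hx => integrable_nonlocal_of_hasC4Bound hd hs hγ hD hδ (hballD x hx)
      (hAK x (hΩsub hx)) hu
  have hbdisc : ∀ x ∈ grid Ω δ (ρ * δ) ∩ Ω,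
      c / 2 ≤ discreteOperator Ω A γ₁ δ (ρ * δ) wt b x := by
    intro x hx
    linarith [(abs_le.1 (hdisc hbB x hx)).1, hbL x (hΩsub hx.2)]
  have hbnonl : ∀ x ∈ Ω, c / 2 ≤ nonlocalOperator A γ₁ δ b x := by
    intro x hx
    linarith [(abs_le.1 (hnonl hbB x hx)).1, hbL x (hΩsub hx)]
  have hstab : ∀ {e : EuclideanSpace ℝ (Fin d) → ℝ} {m : ℝ}, 0 < m →
      (∀ x ∈ grid Ω δ (ρ * δ) ∩ Ω, |discreteOperator Ω A γ₁ δ (ρ * δ) wt e x| ≤ m) →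
      (∀ x ∈ grid Ω δ (ρ * δ) ∩ nonlocalBoundary Ω δ, e x = 0) →
      ∀ x ∈ grid Ω δ (ρ * δ), |e x| ≤ 2 * m / (c / 2) * B := fun hm he hbd =>
    discrete_stability hd hγ hδ hfin hsubD hApos hwpos (half_pos hc) hb0 hbB' hbdisc hm he hbd
  have huniq : ∀ e : EuclideanSpace ℝ (Fin d) → ℝ,
      (∀ x ∈ grid Ω δ (ρ * δ) ∩ Ω, discreteOperator Ω A γ₁ δ (ρ * δ) wt e x = 0) →
      (∀ x ∈ grid Ω δ (ρ * δ) ∩ nonlocalBoundary Ω δ, e x = 0) →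
      ∀ x ∈ grid Ω δ (ρ * δ), e x = 0 := by
    intro e he hbd x hx
    by_contra hne
    have hpos : 0 < |e x| := abs_pos.2 hne
    -- The stability estimate needs `m > 0`. This `m`, proportional to `|e x|`, yields `|e x| ≤ |e
    -- x| * B / (2 * (B + 1))`, impossible unless `e x = 0`.
    have h1 := hstab (e := e) (m := c * |e x| / (8 * (B + 1))) (by positivity)
      (fun z hz => by rw [he z hz, abs_zero]; positivity) hbd x hx
    have h2 : 2 * (c * |e x| / (8 * (B + 1))) / (c / 2) * B = |e x| * B / (2 * (B + 1)) := by
      field_simp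
      ring
    rw [h2, le_div_iff₀ (by positivity)] at h1
    nlinarith
  have hadd : ∀ (u v : EuclideanSpace ℝ (Fin d) → ℝ) (x : EuclideanSpace ℝ (Fin d)),
      discreteOperator Ω A γ₁ δ (ρ * δ) wt (fun y => u y + (-1) * v y) x =
        discreteOperator Ω A γ₁ δ (ρ * δ) wt u x +
          (-1) * discreteOperator Ω A γ₁ δ (ρ * δ) wt v x :=
    fun u v x => discreteOperator_add_mul (hfin.subset neighbors_subset_grid) u v (-1)
  obtain ⟨uh, huh⟩ := exists_isDiscreteSolution hfin huniq f uD
  have hm : 0 < Cu * δ ^ 2 := by positivity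
  have hCle : 2 * (Cu * δ ^ 2) / (c / 2) * B ≤ C * δ ^ 2 := by
    have h1 : 2 * (Cu * δ ^ 2) / (c / 2) * B = (2 * Cu / (c / 2) * B) * δ ^ 2 := by ring
    rw [h1]
    exact mul_le_mul_of_nonneg_right (by linarith) (by positivity)
  have hbdu0 : ∀ x ∈ nonlocalBoundary Ω δ, u0 x = uD x := fun x hx =>
    hu0D x (nonlocalBoundary_mono hδbar'.le hx)
  -- On the interior grid the discrete operator applied to `uh - u0` is exactly minus the
  -- consistency error of `u0`, because `uh` solves the scheme and `u0` the limit equation.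
  have herr : ∀ x ∈ grid Ω δ (ρ * δ), |uh x - u0 x| ≤ C * δ ^ 2 := by
    intro x hx
    have h1 := hstab (e := fun y => uh y + (-1) * u0 y) hm (fun z hz => ?_) (fun z hz => ?_) x hx
    · have h2 : uh x + (-1) * u0 x = uh x - u0 x := by ring
      rw [h2] at h1
      exact h1.trans hCle
    · rw [hadd]
      have h2 := huh.equation z hz
      have h3 := hdisc huK z hz
      rw [hlim z hz.2] at h3
      have h4 : discreteOperator Ω A γ₁ δ (ρ * δ) wt uh z +
          (-1) * discreteOperator Ω A γ₁ δ (ρ * δ) wt u0 z =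
          -(discreteOperator Ω A γ₁ δ (ρ * δ) wt u0 z - -f z) := by linarith
      rw [h4, abs_neg]
      refine h3.trans (mul_le_mul_of_nonneg_right (by linarith) (by positivity))
    · simp only [huh.boundary z hz, hbdu0 z hz.2]
      ring
  refine ⟨uh, huh, fun v hv x hx => ?_, fun uδ huδ hC4 x hx => ?_, fun x hx => ?_⟩
  · have h1 := huniq (fun y => v y + (-1) * uh y) (fun z hz => ?_) (fun z hz => ?_) x hx
    · linarith
    · rw [hadd]
      linarith [hv.equation z hz, huh.equation z hz]
    · rw [hv.boundary z hz, huh.boundary z hz]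
      ring
  · obtain ⟨E, hE⟩ := hC4
    have hE0 : 0 ≤ E := hE.nonneg_of_mem hx₁
    have hsub := fun z hz => nonlocalOperator_add_mul (huδ.integrable z hz) (hint huK z hz) (-1)
    -- Regularity of `uδ` enters only through its boundedness on `Ω`, as the finite bound `E + K'`.
    -- The size of the error comes from the consistency of `u0` alone, so `uδ` may even jump across
    -- the boundary.
    have h1 := nonlocal_stability hd hs hγ hδ hball hsubD hApos hA.upper (half_pos hc) hb0 hbB'
      (hint hbB) hbnonl (e := fun y => uδ y + (-1) * u0 y) (E := E + K') hm
      (fun z hz => (hsub z hz).1) (fun z hz => ?_) (fun z hz => ?_) (fun z hz => ?_) x hx.2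
    · have h2 : uh x - uδ x = (uh x - u0 x) - (uδ x + (-1) * u0 x) := by ring
      have h3 := herr x hx
      have h4 := abs_sub (uh x - u0 x) (uδ x + (-1) * u0 x)
      rw [h2]
      linarith
    · rw [(hsub z hz).2]
      have h2 := huδ.equation z hz
      have h3 := hnonl huK z hz
      rw [hlim z hz] at h3
      have h4 : nonlocalOperator A γ₁ δ uδ z + (-1) * nonlocalOperator A γ₁ δ u0 z =
          -(nonlocalOperator A γ₁ δ u0 z - -f z) := by linarith
      rw [h4, abs_neg]
      exact h3.trans (mul_le_mul_of_nonneg_right (by linarith) (by positivity))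
    · rcases hz with hz | hz
      · have h2 : uδ z + (-1) * u0 z = uδ z - u0 z := by ring
        rw [h2]
        linarith [abs_sub (uδ z) (u0 z), hE.abs_le hz, huK.abs_le (hΩsub hz)]
      · rw [huδ.boundary z hz, hbdu0 z hz]
        have h2 : uD z + (-1) * uD z = 0 := by ring
        rw [h2, abs_zero]
        linarith
    · rw [huδ.boundary z hz, hbdu0 z hz]
      ring
  · have h1 : 0 ≤ C * δ ^ 2 := by positivity
    linarith [herr x hx]
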